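/- Let $\mathcal K$ be a (locally small) 2-category. Assume that $\mathcal K$ has flexible limits, that is, all 2-categorical limits constructible from small products, inserters, equifiers and splittings of idempotents. A morphism $f\colon A\to B$ of $\mathcal K$ is a *representable isofibration* if for all $g\colon X\to A$, $h\colon X\to B$ and every invertible 2-cell $\alpha\colon fg\cong h$ there is an invertible 2-cell $\alpha'\colon g\cong h'$ with $fh'=h$ and $f\alpha'=\alpha$. It is a *normal isofibration* if, moreover, such pairs $(\alpha',h')$ can be chosen for all $(g,\alpha,h)$ naturally in $X$ and so that $\alpha'$ is an identity whenever $\alpha$ is. Let $n\mathcal K$ be the simplicially enriched category with the same objects and the same underlying category as $\mathcal K$ and with $n\mathcal K(A,B)=N(\mathcal K(A,B))$, the nerve of the hom-category. A *2-cosmos structure* on $\mathcal K$ is an $\infty$-cosmos structure on $n\mathcal K$: a class of morphisms, called *isofibrations*, closed under composition and containing the isomorphisms, such that 1. each $n\mathcal K(A,B)$ is a quasicategory; 2. $n\mathcal K(A,p)\colon n\mathcal K(A,B)\to n\mathcal K(A,C)$ is an isofibration of quasicategories for each isofibration $p\colon B\to C$ and each object $A$; 3. $n\mathcal K$ has (as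 simplicially enriched limits) small products, powers by simplicial sets, pullbacks along isofibrations, and limits of countable towers $\cdots\to A_2\to A_1\to A_0$ of isofibrations; 4. the class of isofibrations is stable under pullback; is closed under products, under limits of countable towers (the projection $\lim_n A_n\to A_0$ is an isofibration) and under Leibniz powers by monomorphisms of simplicial sets (if $i\colon S\to T$ is a monomorphism and $p\colon A\to B$ is an isofibration, then so is the induced map $A^T\to A^S\times_{B^S}B^T$); and contains all maps with terminal codomain. The structure is *Cauchy-complete* if idempotents split in $\mathcal K$ and every retract of an isofibration is an isofibration. If every representable isofibration in $\mathcal K$ is normal, then there is exactly one class of morphisms of $\mathcal K$ that is the class of isofibrations of a Cauchy-complete 2-cosmos structure on $\mathcal K$. -/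

import Mathlib

open CategoryTheory

universe v u

namespace TwoCosmos

section Flexible

open Bicategory

/-! ### Limits in a 2-category

A 2-category is a strict bicategory. Each universal property below has a 1-dimensional part
and a 2-dimensional part; together they say that the canonical comparison functor out of
`X ⟶ P` is an isomorphism of categories, for every object `X`. -/

variable {K : Type u} [Bicategory.{v, v} K]

/-- `π` exhibits `P` as the (2-categorical) product of the family `A`. -/
structure IsTwoProduct {J : Type v} {A : J → K} {P : K} (π : ∀ j, P ⟶ A j) : Prop where
  one_dim : ∀ {X : K} (f : ∀ j, X ⟶ A j), ∃! u : X ⟶ P, ∀ j, u ≫ π j = f j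
  two_dim : ∀ {X : K} (g h : X ⟶ P) (α : ∀ j, g ≫ π j ⟶ h ≫ π j),
    ∃! β : g ⟶ h, ∀ j, β ▷ π j = α j

/-- The 2-cell `(u ≫ p) ≫ f ⟶ (u ≫ p) ≫ g` obtained by restricting `l : p ≫ f ⟶ p ≫ g`
along `u`. -/
def restrictCell {X I A B : K} {p : I ⟶ A} {f g : A ⟶ B} (l : p ≫ f ⟶ p ≫ g) (u : X ⟶ I) :
    (u ≫ p) ≫ f ⟶ (u ≫ p) ≫ g :=
  (α_ u p f).hom ≫ u ◁ l ≫ (α_ u p g).inv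

/-- `(I, p, l)` is an inserter of the parallel pair `f, g : A ⟶ B`: the universal 1-cell `p` into
`A` equipped with a (not necessarily invertible) 2-cell `l : p ≫ f ⟶ p ≫ g`. -/
structure IsInserter {I A B : K} {f g : A ⟶ B} (p : I ⟶ A) (l : p ≫ f ⟶ p ≫ g) : Prop where
  one_dim : ∀ {X : K} (a : X ⟶ A) (α : a ≫ f ⟶ a ≫ g),
    ∃! u : X ⟶ I, ∃ h : u ≫ p = a,
      restrictCell l u ≫ eqToHom h ▷ g = eqToHom h ▷ f ≫ α
  two_dim : ∀ {X : K} (u u' : X ⟶ I) (β : u ≫ p ⟶ u' ≫ p),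
    restrictCell l u ≫ β ▷ g = β ▷ f ≫ restrictCell l u' → ∃! γ : u ⟶ u', γ ▷ p = β

/-- `(E, p)` is an equifier of the parallel pair of 2-cells `σ, τ : f ⟶ g`. -/
structure IsEquifier {E A B : K} {f g : A ⟶ B} (σ τ : f ⟶ g) (p : E ⟶ A) : Prop where
  equifies : p ◁ σ = p ◁ τ
  one_dim : ∀ {X : K} (a : X ⟶ A), a ◁ σ = a ◁ τ → ∃! u : X ⟶ E, u ≫ p = a
  two_dim : ∀ {X : K} (u u' : X ⟶ E) (β : u ≫ p ⟶ u' ≫ p), ∃! γ : u ⟶ u', γ ▷ p = β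

variable (K) in
/-- `K` has flexible limits. Flexible limits are the 2-categorical limits constructible from
(small) products, inserters, equifiers and splittings of idempotents, so having all of them
means having these four kinds of limit. -/
structure HasFlexibleLimits [Bicategory.Strict K] : Prop where
  products : ∀ {J : Type v} (A : J → K), ∃ (P : K) (π : ∀ j, P ⟶ A j), IsTwoProduct π
  inserters : ∀ {A B : K} (f g : A ⟶ B),
    ∃ (I : K) (p : I ⟶ A) (l : p ≫ f ⟶ p ≫ g), IsInserter p l
  equifiers : ∀ {A B : K} {f g : A ⟶ B} (σ τ : f ⟶ g), ∃ (E : K) (p : E ⟶ A), IsEquifier σ τ p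
  idempotents : IsIdempotentComplete K

end Flexible

section Isofibrations

open Bicategory

/-! ### Representable and normal isofibrations in a 2-category -/

variable {K : Type u} [Bicategory.{v, v} K]

/-- A lifting along `f : A ⟶ B` of the invertible 2-cell `α : f ∘ g ≅ h`: a 1-cell `h'` and an
invertible 2-cell `α' : g ≅ h'` with `f ∘ h' = h` and `f ∘ α' = α`. -/
@[ext]
structure IsoLift {A B X : K} (f : A ⟶ B) (g : X ⟶ A) (h : X ⟶ B) (α : g ≫ f ≅ h) where
  obj : X ⟶ A
  iso : g ≅ obj
  obj_comp : obj ≫ f = h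
  iso_comp : iso.hom ▷ f ≫ eqToHom obj_comp = α.hom

/-- The identity 2-cell on `g`, as a lifting of the identity 2-cell on `f ∘ g`. -/
def IsoLift.refl {A B X : K} (f : A ⟶ B) (g : X ⟶ A) : IsoLift f g (g ≫ f) (Iso.refl _) where
  obj := g
  iso := Iso.refl g
  obj_comp := rfl
  iso_comp := by simp

/-- The invertible 2-cell `α k : f ∘ (g ∘ k) ≅ h ∘ k`. -/
def restrictIso {A B X Y : K} {f : A ⟶ B} {g : X ⟶ A} {h : X ⟶ B} (k : Y ⟶ X)
    (α : g ≫ f ≅ h) : (k ≫ g) ≫ f ≅ k ≫ h :=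
  α_ k g f ≪≫ whiskerLeftIso k α

/-- The restriction `(h' ∘ k, α' k)` of a lifting `(h', α')` along `k : Y ⟶ X`. -/
def IsoLift.restrict [Bicategory.Strict K] {A B X Y : K} {f : A ⟶ B} {g : X ⟶ A} {h : X ⟶ B}
    {α : g ≫ f ≅ h} (l : IsoLift f g h α) (k : Y ⟶ X) :
    IsoLift f (k ≫ g) (k ≫ h) (restrictIso k α) where
  obj := k ≫ l.obj
  iso := whiskerLeftIso k l.iso
  obj_comp := by rw [Bicategory.Strict.assoc, l.obj_comp]
  iso_comp := by
    have e := l.iso_comp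
    simp [restrictIso, ← e, Bicategory.Strict.associator_eqToIso]

/-- `f : A ⟶ B` is a representable isofibration: each `K(X, f)` is an isofibration of
categories. -/
def IsRepresentableIsofibration {A B : K} (f : A ⟶ B) : Prop :=
  ∀ {X : K} (g : X ⟶ A) (h : X ⟶ B) (α : g ≫ f ≅ h), Nonempty (IsoLift f g h α)

/-- A cleavage for `f`: a choice of liftings, natural in `X`. -/
structure Cleavage [Bicategory.Strict K] {A B : K} (f : A ⟶ B) where
  lift : ∀ {X : K} (g : X ⟶ A) (h : X ⟶ B) (α : g ≫ f ≅ h), IsoLift f g h α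
  natural : ∀ {X Y : K} (k : Y ⟶ X) (g : X ⟶ A) (h : X ⟶ B) (α : g ≫ f ≅ h),
    lift (k ≫ g) (k ≫ h) (restrictIso k α) = (lift g h α).restrict k

/-- A cleavage is normal if the chosen lifting of an identity 2-cell is an identity. -/
def Cleavage.IsNormal [Bicategory.Strict K] {A B : K} {f : A ⟶ B} (c : Cleavage f) : Prop :=
  ∀ {X : K} (g : X ⟶ A), c.lift g (g ≫ f) (Iso.refl _) = IsoLift.refl f g

/-- A normal isofibration is a representable isofibration supporting a normal cleavage. -/
def IsNormalIsofibration [Bicategory.Strict K] {A B : K} (f : A ⟶ B) : Prop :=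
  IsRepresentableIsofibration f ∧ ∃ c : Cleavage f, c.IsNormal

end Isofibrations

section Nerve

open Bicategory MonoidalCategory

/-! ### The simplicially enriched category obtained from a 2-category by taking nerves of homs -/

variable (K : Type u) [Bicategory.{v, v} K]

/-- Horizontal composition, as a functor. -/
@[simps]
def compFunctor (X Y Z : K) : (X ⟶ Y) × (Y ⟶ Z) ⥤ (X ⟶ Z) where
  obj p := p.1 ≫ p.2
  map φ := φ.1 ▷ _ ≫ _ ◁ φ.2
  map_comp φ ψ := by
    simp [Bicategory.whisker_exchange_assoc]

/-- Horizontal composition, on nerves of hom-categories. -/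
def nerveComp (X Y Z : K) : nerve (X ⟶ Y) ⊗ nerve (Y ⟶ Z) ⟶ nerve (X ⟶ Z) where
  app _ := ↾fun p ↦ Functor.prod' p.1 p.2 ⋙ compFunctor K X Y Z

/-- For a 2-category `K`, the simplicially enriched category `nK` with the same objects and the
same underlying category as `K`, whose simplicial homs are the nerves of the hom-categories
of `K`. -/
noncomputable instance nerveEnrichment [Bicategory.Strict K] : SimplicialCategory K where
  Hom X Y := nerve (X ⟶ Y)
  id X := (nerve (X ⟶ X)).unitHomEquiv.symm (ComposableArrows.mk₀ (𝟙 X))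
  comp X Y Z := nerveComp K X Y Z
  id_comp X Y := by
    ext n F
    change Fin (n.unop.len + 1) ⥤ (X ⟶ Y) at F
    refine CategoryTheory.Functor.ext (fun i ↦ Bicategory.Strict.id_comp _) (fun i j φ ↦ ?_)
    change 𝟙 (𝟙 X) ▷ F.obj i ≫ 𝟙 X ◁ F.map φ = eqToHom _ ≫ F.map φ ≫ eqToHom _
    simp [Bicategory.Strict.leftUnitor_eqToIso]
  comp_id X Y := by
    ext n F
    change Fin (n.unop.len + 1) ⥤ (X ⟶ Y) at F
    refine CategoryTheory.Functor.ext (fun i ↦ Bicategory.Strict.comp_id _) (fun i j φ ↦ ?_)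
    change F.map φ ▷ 𝟙 Y ≫ F.obj j ◁ 𝟙 (𝟙 Y) = eqToHom _ ≫ F.map φ ≫ eqToHom _
    simp [Bicategory.Strict.rightUnitor_eqToIso]
  assoc W X Y Z := by
    ext n F
    obtain ⟨F, G, H⟩ := F
    change Fin (n.unop.len + 1) ⥤ (W ⟶ X) at F
    change Fin (n.unop.len + 1) ⥤ (X ⟶ Y) at G
    change Fin (n.unop.len + 1) ⥤ (Y ⟶ Z) at H
    refine CategoryTheory.Functor.ext (fun i ↦ Bicategory.Strict.assoc _ _ _) (fun i j φ ↦ ?_)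
    change (F.map φ ▷ G.obj i ≫ F.obj j ◁ G.map φ) ▷ H.obj i ≫ (F.obj j ≫ G.obj j) ◁ H.map φ =
      eqToHom (Bicategory.Strict.assoc _ _ _) ≫ (F.map φ ▷ (G.obj i ≫ H.obj i) ≫
        F.obj j ◁ (G.map φ ▷ H.obj i ≫ G.obj j ◁ H.map φ)) ≫
        eqToHom (Bicategory.Strict.assoc _ _ _).symm
    simp [Bicategory.Strict.associator_eqToIso]
  homEquiv {X Y} := nerveEquiv.symm.trans (nerve (X ⟶ Y)).unitHomEquiv.symm
  homEquiv_id X := rfl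
  homEquiv_comp f g := by
    ext n F
    refine CategoryTheory.Functor.ext (fun i ↦ rfl) (fun i j φ ↦ ?_)
    change 𝟙 (f ≫ g) = 𝟙 (f ≫ g) ≫ (𝟙 f ▷ g ≫ f ◁ 𝟙 g) ≫ 𝟙 (f ≫ g)
    simp

end Nerve

section InfinityCosmos

open MonoidalCategory Limits Opposite Simplicial

/-! ### ∞-cosmoi -/

/-- Isofibrations of quasicategories: simplicial maps with the right lifting property against
the inner horn inclusions and against the inclusion of either vertex into the nerve of the
free-living isomorphism. -/
def IsQCatIsofibration {S T : SSet.{v}} (p : S ⟶ T) : Prop :=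
  SSet.innerFibrations p ∧
    HasLiftingProperty (SSet.const SSet.coherentIso.x₀ : (Δ[0] : SSet.{v}) ⟶ SSet.coherentIso) p ∧
    HasLiftingProperty (SSet.const SSet.coherentIso.x₁ : (Δ[0] : SSet.{v}) ⟶ SSet.coherentIso) p

variable {C : Type u} [Category.{v} C] [SimplicialCategory C]

open SimplicialCategory

/-- The map `sHom B P ⟶ [S, sHom B A]` induced by a map `κ : S ⟶ sHom P A`. -/
noncomputable def powerComparison {A P : C} {S : SSet.{v}} (κ : S ⟶ sHom P A) (B : C) :
    sHom B P ⟶ (ihom S).obj (sHom B A) :=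
  MonoidalClosed.curry ((β_ S (sHom B P)).hom ≫ sHom B P ◁ κ ≫ sHomComp B P A)

/-- `κ` exhibits `P` as the power of `A` by the simplicial set `S`. -/
def IsPower {A P : C} {S : SSet.{v}} (κ : S ⟶ sHom P A) : Prop :=
  ∀ B : C, IsIso (powerComparison κ B)

/-- Given powers `κ` of `A` by `T` and `κ'` of `B` by `S`, a map `i : S ⟶ T` and a morphism
`p : A ⟶ B`, this says that `m` is the induced morphism `p ^ i : A ^ T ⟶ B ^ S`. -/
def IsPowerMap {A B P Q : C} {S T : SSet.{v}} (κ : T ⟶ sHom P A) (κ' : S ⟶ sHom Q B)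
    (i : S ⟶ T) (p : A ⟶ B) (m : P ⟶ Q) : Prop :=
  κ' ≫ eHomWhiskerRight SSet m B = i ≫ κ ≫ eHomWhiskerLeft SSet P p

/-- `l : AT ⟶ L` is a Leibniz power of `p : A ⟶ B` by `i : S ⟶ T`: the comparison morphism
`A ^ T ⟶ A ^ S ×_{B ^ S} B ^ T` from a power `AT` of `A` by `T` to a pullback `L`. -/
def IsLeibnizPower {A B : C} {S T : SSet.{v}} (i : S ⟶ T) (p : A ⟶ B) {AT L : C} (l : AT ⟶ L) :
    Prop :=
  ∃ (AS BT BS : C) (κAT : T ⟶ sHom AT A) (κAS : S ⟶ sHom AS A) (κBT : T ⟶ sHom BT B)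
    (κBS : S ⟶ sHom BS B) (pT : AT ⟶ BT) (pS : AS ⟶ BS) (Ai : AT ⟶ AS) (Bi : BT ⟶ BS)
    (fst : L ⟶ AS) (snd : L ⟶ BT),
    (IsPower κAT ∧ IsPower κAS ∧ IsPower κBT ∧ IsPower κBS) ∧
    IsPowerMap κAT κBT (𝟙 T) p pT ∧ IsPowerMap κAS κBS (𝟙 S) p pS ∧
    IsPowerMap κAT κAS i (𝟙 A) Ai ∧ IsPowerMap κBT κBS i (𝟙 B) Bi ∧
    IsPullback fst snd pS Bi ∧ l ≫ fst = Ai ∧ l ≫ snd = pT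

/-- A tower `⋯ ⟶ F 2 ⟶ F 1 ⟶ F 0` all of whose structure morphisms are in `W`. -/
def IsTowerOf (W : MorphismProperty C) (F : ℕᵒᵖ ⥤ C) : Prop :=
  ∀ n : ℕ, W (F.map (homOfLE (Nat.le_succ n)).op)

variable (C) in
/-- The class `W` of morphisms, as the class of isofibrations, makes the simplicially enriched
category `C` an ∞-cosmos. The limits in the first group of axioms are simplicially enriched, and
hence any limit in the underlying category of one of the diagrams concerned is so too. -/
structure IsInfinityCosmos (W : MorphismProperty C) : Prop where
  comp : W.IsStableUnderComposition
  iso : ∀ {A B : C} (f : A ⟶ B), IsIso f → W f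
  quasicategory : ∀ A B : C, SSet.Quasicategory (sHom A B)
  hom_isofibration : ∀ (A : C) {B D : C} (p : B ⟶ D), W p →
    IsQCatIsofibration (eHomWhiskerLeft SSet A p)
  hasProducts : Enriched.HasConicalProducts.{v} SSet.{v} C
  hasPowers : ∀ (A : C) (S : SSet.{v}), ∃ (P : C) (κ : S ⟶ sHom P A), IsPower κ
  hasPullbacks : ∀ {A B D : C} (p : A ⟶ B) (g : D ⟶ B), W p →
    Enriched.HasConicalPullback SSet.{v} p g
  hasTowerLimits : ∀ F : ℕᵒᵖ ⥤ C, IsTowerOf W F → Enriched.HasConicalLimit SSet.{v} F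
  pullback : W.IsStableUnderBaseChange
  product : ∀ J : Type v, W.IsStableUnderLimitsOfShape (Discrete J)
  towerLimit : ∀ F : ℕᵒᵖ ⥤ C, IsTowerOf W F → ∀ c : Cone F, Nonempty (IsLimit c) →
    W (c.π.app (op 0))
  leibniz : ∀ {S T : SSet.{v}} (i : S ⟶ T) {A B : C} (p : A ⟶ B), Mono i → W p →
    ∀ {P L : C} (l : P ⟶ L), IsLeibnizPower i p l → W l
  terminal : ∀ {A T : C} (f : A ⟶ T), Nonempty (IsTerminal T) → W f

variable (C) in
/-- `W` makes `C` a Cauchy-complete ∞-cosmos. -/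
structure IsCauchyCompleteInfinityCosmos (W : MorphismProperty C) : Prop where
  cosmos : IsInfinityCosmos C W
  idempotents : IsIdempotentComplete C
  retracts : W.IsStableUnderRetracts

end InfinityCosmos

/-- `W` is the class of isofibrations of a Cauchy-complete 2-cosmos structure on the 2-category
`K`, that is, of a Cauchy-complete ∞-cosmos structure on `nK`. -/
def IsCauchyCompleteTwoCosmos (K : Type u) [Bicategory.{v, v} K] [Bicategory.Strict K]
    (W : MorphismProperty K) : Prop :=
  IsCauchyCompleteInfinityCosmos K W

end TwoCosmos

/-!
The class in question is that of the representable isofibrations (`repIsofib`).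

*Existence.* The simplicial homs are nerves of hom-categories, and so are the maps between them
that are induced by 1-cells. Since the nerve functor preserves limits, a limit in the
2-categorical sense is a simplicially enriched limit (`IsTwoLimit.hasConicalLimit`). Products are
given; powers by a category `D` are obtained from a product by inserting an action of the
morphisms of `D` and equifying it to be functorial (`HasFlexibleLimits.exists_universalAction`,
`HasFlexibleLimits.exists_powerFunctor`), and powers by a simplicial set `S` are the same as
powers by its homotopy category, because maps from `S` to a nerve are functors out of the homotopy
category, and taking homotopy categories preserves binary products (`isPower_iff`).

Pullbacks and limits of towers are not flexible limits, and this is where normality enters. An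
equalizer of two 1-cells can be extracted from their iso-inserter by splitting an idempotent, as
soon as the universal invertible 2-cell can be strictified in a way that changes nothing where it
is already an identity (`HasFlexibleLimits.exists_twoEqualizer`). For a pullback of `f`,
strictification means transporting along the invertible 2-cell by a cleavage of `f`, and normality
of the cleavage is the condition that nothing changes on identities; for a tower one transports
successively at each stage (`HasFlexibleLimits.hasConicalPullback`,
`HasFlexibleLimits.hasConicalLimit_tower`).

A 1-cell is a representable isofibration if and only if all simplicial hom-functors send it to a
map with the right lifting property against the inclusion of a point in the free-living
isomorphism, and this gives most of the closure properties (`repIsofib_iff`). For Leibniz powers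
by a monomorphism `S ⟶ T`, isomorphisms of functors on the homotopy category of `T` are lifted
object by object, using the prescribed values at the objects of `S`; functoriality is then
transported (`repIsofib_of_isLeibnizPower`).

*Uniqueness.* The isofibrations of any 2-cosmos structure are representable isofibrations, since
nerves detect these. Conversely, let `f : A ⟶ B` be a representable isofibration, and `E` the
object of isomorphisms `f a ≅ b`. The projection `E ⟶ B` is an isofibration in any 2-cosmos
structure, being built from a Leibniz power and pullbacks (`IsInfinityCosmos.exists_isoComma`),
and `f` is a retract of it: the section `A ⟶ E` is given by identities, and the retraction by a
normal cleavage (`IsInfinityCosmos.of_isNormalIsofibration`). As isofibrations are closed under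
retracts, `f` is one.
-/

namespace TwoCosmos

/-! ### Heterogeneous equality of 2-cells, and nerves of hom-functors -/

section HEq

variable {C : Type*} [Category* C]

lemma comp_heq_comp {a b c a' b' c' : C} {f : a ⟶ b} {g : b ⟶ c} {f' : a' ⟶ b'} {g' : b' ⟶ c'}
    (ha : a = a') (hb : b = b') (hc : c = c') (hf : HEq f f') (hg : HEq g g') :
    HEq (f ≫ g) (f' ≫ g') := by
  subst ha hb hc
  rw [eq_of_heq hf, eq_of_heq hg]

lemma eqToHom_conj_heq {a b a' b' : C} (f : a ⟶ b) (ha : a' = a) (hb : b = b') :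
    HEq (eqToHom ha ≫ f ≫ eqToHom hb) f := by
  subst ha hb
  simp

lemma functor_map_heq {C D : Type*} [Category* C] [Category* D] {G G' : C ⥤ D} (h : G = G')
    {a b : C} (f : a ⟶ b) : HEq (G.map f) (G'.map f) := by
  rw [h]

lemma map_heq {C D : Type*} [Category* C] [Category* D] (G : C ⥤ D) {a b a' b' : C} {f : a ⟶ b}
    {f' : a' ⟶ b'} (ha : a = a') (hb : b = b') (h : HEq f f') : HEq (G.map f) (G.map f') := by
  subst ha hb
  rw [eq_of_heq h]

lemma id_heq_id {a b : C} (h : a = b) : HEq (𝟙 a) (𝟙 b) := by rw [h]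

end HEq

section Whiskering

open Bicategory

variable {K : Type u} [Bicategory.{v, v} K]

lemma whiskerRight_heq {A B C : K} {f f' g g' : A ⟶ B} {η : f ⟶ g} {η' : f' ⟶ g'} (hf : f = f')
    (hg : g = g') (h : HEq η η') (k : B ⟶ C) : HEq (η ▷ k) (η' ▷ k) := by
  subst hf hg
  rw [eq_of_heq h]

lemma whiskerLeft_heq {A B C : K} {f f' g g' : B ⟶ C} {η : f ⟶ g} {η' : f' ⟶ g'} (hf : f = f')
    (hg : g = g') (h : HEq η η') (k : A ⟶ B) : HEq (k ◁ η) (k ◁ η') := by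
  subst hf hg
  rw [eq_of_heq h]

lemma whiskerLeft_congr_heq {A B C : K} {k k' : A ⟶ B} (hk : k = k') {f g : B ⟶ C} (η : f ⟶ g) :
    HEq (k ◁ η) (k' ◁ η) := by
  rw [hk]

variable [Bicategory.Strict K]

lemma whiskerRight_comp_heq {A B C D : K} {f g : A ⟶ B} (η : f ⟶ g) (h : B ⟶ C) (k : C ⟶ D) :
    HEq (η ▷ (h ≫ k)) (η ▷ h ▷ k) := by
  simp [Bicategory.Strict.associator_eqToIso]

lemma comp_whiskerLeft_heq {A B C D : K} (h : A ⟶ B) (k : B ⟶ C) {f g : C ⟶ D} (η : f ⟶ g) :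
    HEq ((h ≫ k) ◁ η) (h ◁ k ◁ η) := by
  simp [Bicategory.Strict.associator_eqToIso]

lemma whisker_assoc_heq {A B C D : K} (h : A ⟶ B) {f g : B ⟶ C} (η : f ⟶ g) (k : C ⟶ D) :
    HEq ((h ◁ η) ▷ k) (h ◁ η ▷ k) := by
  simp [Bicategory.Strict.associator_eqToIso]

lemma id_whiskerLeft_heq {A B : K} {f g : A ⟶ B} (η : f ⟶ g) : HEq (𝟙 A ◁ η) η := by
  simp [Bicategory.Strict.leftUnitor_eqToIso]

lemma whiskerRight_id_heq {A B : K} {f g : A ⟶ B} (η : f ⟶ g) : HEq (η ▷ 𝟙 B) η := by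
  simp [Bicategory.Strict.rightUnitor_eqToIso]

lemma restrictCell_heq {X I A B : K} {p : I ⟶ A} {f g : A ⟶ B} (l : p ≫ f ⟶ p ≫ g) (u : X ⟶ I) :
    HEq (restrictCell l u) (u ◁ l) := by
  simp [restrictCell, Bicategory.Strict.associator_eqToIso]

end Whiskering

section Nerve

open Bicategory MonoidalCategory Limits Opposite Simplicial SimplicialCategory

variable {K : Type u} [Bicategory.{v, v} K] [Bicategory.Strict K]

/-- The simplicial map `nK(X, f)` is the nerve of the functor `K(X, f)`. -/
lemma eHomWhiskerLeft_eq (X : K) {A B : K} (f : A ⟶ B) :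
    eHomWhiskerLeft SSet.{v} X f = nerveMap (postcomp X f) := by
  ext n F
  change Fin (n.unop.len + 1) ⥤ (X ⟶ A) at F
  refine CategoryTheory.Functor.ext (fun i ↦ rfl) (fun i j φ ↦ ?_)
  change F.map φ ▷ f ≫ _ ◁ 𝟙 f = 𝟙 _ ≫ F.map φ ▷ f ≫ 𝟙 _
  simp

/-- The simplicial map `nK(u, A)` is the nerve of the functor `K(u, A)`. -/
lemma eHomWhiskerRight_eq {X Y : K} (u : X ⟶ Y) (A : K) :
    eHomWhiskerRight SSet.{v} u A = nerveMap (precomp A u) := by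
  ext n F
  change Fin (n.unop.len + 1) ⥤ (Y ⟶ A) at F
  refine CategoryTheory.Functor.ext (fun i ↦ rfl) (fun i j φ ↦ ?_)
  change 𝟙 u ▷ _ ≫ u ◁ F.map φ = 𝟙 _ ≫ u ◁ F.map φ ≫ 𝟙 _
  simp

/-- `A ↦ K(X, A)`, as a functor to the category of categories. -/
@[simps]
def homCat (X : K) : K ⥤ Cat.{v, v} where
  obj A := Cat.of (X ⟶ A)
  map f := (postcomp X f).toCatHom
  map_id A := by
    ext1
    exact Functor.hext (fun f ↦ Strict.comp_id f) (fun f g η ↦ whiskerRight_id_heq η)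
  map_comp f g := by
    ext1
    exact Functor.hext (fun k ↦ (Strict.assoc k f g).symm)
      (fun k l η ↦ whiskerRight_comp_heq η f g)

/-- The simplicial hom functor of `nK` is the nerve of the hom functor of `K`. -/
noncomputable def eCoyonedaIso (X : K) : eCoyoneda SSet.{v} X ≅ homCat X ⋙ nerveFunctor :=
  NatIso.ofComponents (fun A ↦ Iso.refl _) (fun f ↦ by
    change eHomWhiskerLeft SSet.{v} X f ≫ 𝟙 _ = 𝟙 _ ≫ nerveMap (postcomp X f)
    rw [eHomWhiskerLeft_eq]
    simp)

end Nerve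

/-! ### Representable isofibrations and isofibrations of quasicategories -/

section FunctorIsofibrations

open Simplicial SSet

/-- A functor is an isofibration if isomorphisms out of the image of an object lift to
isomorphisms out of that object. The equality of isomorphisms in `D` is stated in the arrow
category, so as to include the equality of their codomains. -/
def IsIsofib {C D : Type*} [Category* C] [Category* D] (F : C ⥤ D) : Prop :=
  ∀ (c : C) (d : D) (α : F.obj c ≅ d), ∃ (c' : C) (β : c ≅ c'),
    Arrow.mk (F.map β.hom) = Arrow.mk α.hom

lemma WalkingIso.functor_ext {C : Type*} [Category* C] {F G : WalkingIso ⥤ C}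
    (h : Arrow.mk (F.map WalkingIso.iso.hom) = Arrow.mk (G.map WalkingIso.iso.hom)) : F = G := by
  apply WalkingIso.equiv.injective
  have h₀ : F.obj .zero = G.obj .zero := congrArg (fun x : Arrow C ↦ x.left) h
  have h₁ : F.obj .one = G.obj .one := congrArg (fun x : Arrow C ↦ x.right) h
  have : ∀ (a b a' b' : C) (e : a ≅ b) (e' : a' ≅ b'), Arrow.mk e.hom = Arrow.mk e'.hom →
      (⟨a, b, e⟩ : Σ (X : C) (Y : C), (X ≅ Y)) = ⟨a', b', e'⟩ := by
    intro a b a' b' e e' he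
    obtain rfl : a = a' := congrArg (fun x : Arrow C ↦ x.left) he
    obtain rfl : b = b' := congrArg (fun x : Arrow C ↦ x.right) he
    obtain rfl : e = e' := Iso.ext (Arrow.mk_injective _ _ he)
    rfl
  exact this _ _ _ _ (WalkingIso.toIso F) (WalkingIso.toIso G) h

lemma yonedaEquiv_spine {X : SSet.{v}} {n : ℕ} (σ : Δ[n] ⟶ X) :
    X.spine n (SSet.yonedaEquiv σ) = (stdSimplex.spineId n).map σ := by
  ext i
  · exact ((σ.naturality_apply _ _).symm : _)
  · exact ((σ.naturality_apply _ _).symm : _)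

variable {C D : Type v} [SmallCategory C] [SmallCategory D]

/-- Inner horns in a nerve have fillers, and these are unique since an inner horn contains the
spine of the simplex. -/
lemma nerve_innerFibrations (F : C ⥤ D) : innerFibrations (nerveMap F) := by
  rintro _ _ _ ⟨i, h0, hn⟩
  refine ⟨fun {t b} sq ↦ ?_⟩
  obtain ⟨σ, hσ⟩ := Quasicategory.hornFilling h0 hn t
  refine ⟨⟨⟨σ, hσ.symm, ?_⟩⟩⟩
  apply SSet.yonedaEquiv.injective
  apply (Nerve.strictSegal D).spineInjective
  have h := sq.w
  rw [hσ, Category.assoc] at h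
  change (nerve D).spine _ _ = (nerve D).spine _ _
  rw [yonedaEquiv_spine, yonedaEquiv_spine, ← horn.spineId_map_hornInclusion i h0 hn]
  exact congrArg (fun f ↦ (horn.spineId i h0 hn).map f) h

/-- The nerve functor is full. -/
lemma exists_nerveMap_eq (φ : nerve C ⟶ nerve D) : ∃ F : C ⥤ D, nerveMap F = φ := by
  obtain ⟨F, hF⟩ := nerveFunctor.map_surjective (X := Cat.of C) (Y := Cat.of D) φ
  exact ⟨F.toFunctor, hF⟩

lemma nerveMap_injective {F G : C ⥤ D} (h : nerveMap F = nerveMap G) : F = G :=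
  congrArg (·.toFunctor) (nerveFunctor.map_injective (a₁ := F.toCatHom) (a₂ := G.toCatHom) h)

lemma exists_const_eq {X : SSet.{v}} (t : Δ[0] ⟶ X) : ∃ x : X _⦋0⦌, t = SSet.const x :=
  ⟨SSet.yonedaEquiv t, SSet.yonedaEquiv.injective (by rw [yonedaEquiv_const])⟩

lemma const_mk₀_injective {c c' : C}
    (h : (SSet.const (ComposableArrows.mk₀ c) : (Δ[0] : SSet.{v}) ⟶ nerve C) =
      SSet.const (ComposableArrows.mk₀ c')) : c = c' := by
  have := congrArg (fun (f : Δ[0] ⟶ nerve C) ↦ SSet.yonedaEquiv f) h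
  exact congrArg (fun F : ComposableArrows C 0 ↦ F.obj 0) this

lemma const_comp {X Y : SSet.{v}} (x : X _⦋0⦌) (f : X ⟶ Y) :
    (SSet.const x : (Δ[0] : SSet.{v}) ⟶ X) ≫ f = SSet.const (f.app _ x) := by
  ext n
  exact f.naturality_apply _ _

/-- The simplicial map out of the nerve of the free-living isomorphism given by a functor. This is
its nerve, but for the universe levels of morphisms. -/
def coherentIsoDesc (F : WalkingIso.{v} ⥤ C) : SSet.coherentIso.{v} ⟶ nerve C where
  app _ := ↾fun X ↦ (F.mapComposableArrows _).obj X

lemma coherentIsoDesc_surjective (φ : SSet.coherentIso.{v} ⟶ nerve C) :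
    ∃ F : WalkingIso.{v} ⥤ C, coherentIsoDesc F = φ := by
  let d : nerve (ULiftHom.{v} WalkingIso.{v}) ⟶ SSet.coherentIso.{v} :=
    { app := fun _ ↦ ↾fun X ↦ (ULiftHom.down.mapComposableArrows _).obj X }
  obtain ⟨G, hG⟩ := exists_nerveMap_eq (d ≫ φ)
  refine ⟨ULiftHom.up ⋙ G, ?_⟩
  have : coherentIsoDesc ULiftHom.up ≫ d = 𝟙 _ := rfl
  calc
    _ = coherentIsoDesc ULiftHom.up ≫ nerveMap G := rfl
    _ = _ := by rw [hG, ← Category.assoc, this, Category.id_comp]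

lemma coherentIsoDesc_injective {F G : WalkingIso.{v} ⥤ C}
    (h : coherentIsoDesc F = coherentIsoDesc G) : F = G := by
  apply WalkingIso.functor_ext
  have : (coherentIsoDesc F).app (.op ⦋1⦌) (ComposableArrows.mk₁ WalkingIso.iso.hom) =
      (coherentIsoDesc G).app (.op ⦋1⦌) (ComposableArrows.mk₁ WalkingIso.iso.hom) := by rw [h]
  exact congrArg (fun H : ComposableArrows C 1 ↦ Arrow.mk H.hom) this

lemma x₀_comp_coherentIsoDesc (F : WalkingIso.{v} ⥤ C) :
    (SSet.const SSet.coherentIso.x₀ : (Δ[0] : SSet.{v}) ⟶ _) ≫ coherentIsoDesc F =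
      SSet.const (ComposableArrows.mk₀ (F.obj .zero)) :=
  (const_comp _ _).trans (congrArg _ (ComposableArrows.ext₀ rfl))

lemma const_comp_nerveMap (c : C) (F : C ⥤ D) :
    (SSet.const (ComposableArrows.mk₀ c) : (Δ[0] : SSet.{v}) ⟶ nerve C) ≫ nerveMap F =
      SSet.const (ComposableArrows.mk₀ (F.obj c)) :=
  (const_comp _ _).trans (congrArg _ (ComposableArrows.ext₀ rfl))

/-- A functor is an isofibration if and only if its nerve has the right lifting property against
the inclusion of the source of the free-living isomorphism. -/
lemma hasLiftingProperty_x₀_iff (F : C ⥤ D) :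
    HasLiftingProperty (SSet.const SSet.coherentIso.x₀ : (Δ[0] : SSet.{v}) ⟶ SSet.coherentIso)
      (nerveMap F) ↔ IsIsofib F := by
  constructor
  · intro h c d α
    have sq : CommSq (SSet.const (ComposableArrows.mk₀ c) : (Δ[0] : SSet.{v}) ⟶ nerve C)
        (SSet.const SSet.coherentIso.x₀) (nerveMap F) (coherentIsoDesc (WalkingIso.fromIso α)) :=
      ⟨by rw [const_comp_nerveMap, x₀_comp_coherentIsoDesc]; rfl⟩
    obtain ⟨G, hG⟩ := coherentIsoDesc_surjective sq.lift
    have h₁ := sq.fac_left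
    have h₂ := sq.fac_right
    rw [← hG] at h₁ h₂
    rw [x₀_comp_coherentIsoDesc] at h₁
    obtain rfl := const_mk₀_injective h₁
    have hF : G ⋙ F = WalkingIso.fromIso α := coherentIsoDesc_injective h₂
    refine ⟨_, WalkingIso.toIso G, ?_⟩
    exact congrArg (fun H : WalkingIso ⥤ D ↦ Arrow.mk (H.map WalkingIso.iso.hom)) hF
  · intro h
    refine ⟨fun {t b} sq ↦ ?_⟩
    obtain ⟨c, rfl⟩ := exists_const_eq t
    obtain ⟨c, rfl⟩ := ComposableArrows.mk₀_surjective c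
    obtain ⟨H, rfl⟩ := coherentIsoDesc_surjective b
    have hw := sq.w
    rw [const_comp_nerveMap, x₀_comp_coherentIsoDesc] at hw
    have hc : F.obj c = H.obj .zero := const_mk₀_injective hw
    obtain ⟨c', β, hβ⟩ := h c _ (eqToIso hc ≪≫ WalkingIso.toIso H)
    refine ⟨⟨⟨coherentIsoDesc (WalkingIso.fromIso β), x₀_comp_coherentIsoDesc _, ?_⟩⟩⟩
    have : WalkingIso.fromIso β ⋙ F = H := by
      apply WalkingIso.functor_ext
      refine hβ.trans ?_
      simp
    rw [← this]
    rfl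

lemma hasLiftingProperty_x₁_iff (F : C ⥤ D) :
    HasLiftingProperty (SSet.const SSet.coherentIso.x₁ : (Δ[0] : SSet.{v}) ⟶ SSet.coherentIso)
      (nerveMap F) ↔ IsIsofib F := by
  rw [← hasLiftingProperty_x₀_iff]
  -- The automorphism of the free-living isomorphism that exchanges the two objects.
  let s : WalkingIso.{v} ⥤ WalkingIso.{v} := Codiscrete.functor (fun x ↦ .up !x.as.down)
  have hs : s ⋙ s = 𝟭 _ := CategoryTheory.Functor.ext (by rintro ⟨⟨_ | _⟩⟩ <;> rfl)
  let e : SSet.coherentIso.{v} ≅ SSet.coherentIso.{v} :=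
    ⟨nerveMap s, nerveMap s, congrArg nerveMap hs, congrArg nerveMap hs⟩
  refine HasLiftingProperty.iff_of_arrow_iso_left ?_ _
  refine Arrow.isoMk (Iso.refl _) e ?_
  exact (Category.id_comp _).trans
    ((const_comp _ _).trans (congrArg _ (ComposableArrows.ext₀ rfl))).symm

end FunctorIsofibrations

section RepresentableIsofibrations

open Bicategory Simplicial SSet Limits Opposite

variable {K : Type u} [Bicategory.{v, v} K]

lemma isRepresentableIsofibration_iff {A B : K} (f : A ⟶ B) :
    IsRepresentableIsofibration f ↔ ∀ X : K, IsIsofib (postcomp X f) := by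
  constructor
  · intro h X g d α
    obtain ⟨l⟩ := h g d α
    obtain ⟨o, i, rfl, hi⟩ := l
    exact ⟨o, i, by simpa using! congrArg Arrow.mk hi⟩
  · intro h X g d α
    obtain ⟨o, i, hi⟩ := h X g d α
    have ho : o ≫ f = d := congrArg (fun x : Arrow (X ⟶ B) ↦ x.right) hi
    subst ho
    exact ⟨⟨o, i, rfl, by simpa using! Arrow.mk_injective _ _ hi⟩⟩

variable (K) in
/-- The class of representable isofibrations. -/
def repIsofib [Bicategory.Strict K] : MorphismProperty K :=
  fun _ _ f ↦ IsRepresentableIsofibration f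

variable [Bicategory.Strict K]

/-- The inclusion of the source of the free-living isomorphism, as a class with one element. -/
def sourceInclusion : MorphismProperty SSet.{v} :=
  .ofHoms (fun (_ : Unit) ↦ (SSet.const SSet.coherentIso.x₀ : (Δ[0] : SSet.{v}) ⟶ SSet.coherentIso))

/-- Representable isofibrations are the morphisms that every simplicial hom functor sends to a map
with a right lifting property. Their stability properties follow from this. -/
lemma repIsofib_iff {A B : K} (f : A ⟶ B) :
    repIsofib K f ↔ ∀ X : K, sourceInclusion.rlp ((eCoyoneda SSet.{v} X).map f) := by
  refine (isRepresentableIsofibration_iff f).trans (forall_congr' fun X ↦ ?_)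
  rw [sourceInclusion, MorphismProperty.rlp_ofHoms_iff_hasLiftingProperty]
  change _ ↔ HasLiftingProperty _ (eHomWhiskerLeft SSet.{v} X f)
  rw [eHomWhiskerLeft_eq, ← hasLiftingProperty_x₀_iff]

lemma isQCatIsofibration_eHomWhiskerLeft_iff (X : K) {A B : K} (f : A ⟶ B) :
    IsQCatIsofibration (eHomWhiskerLeft SSet.{v} X f) ↔ IsIsofib (postcomp X f) := by
  rw [eHomWhiskerLeft_eq, IsQCatIsofibration, hasLiftingProperty_x₀_iff, hasLiftingProperty_x₁_iff]
  exact ⟨fun h ↦ h.2.1, fun h ↦ ⟨nerve_innerFibrations _, h, h⟩⟩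

instance : (repIsofib K).IsStableUnderComposition where
  comp_mem f g hf hg := by
    rw [repIsofib_iff] at *
    intro X
    rw [Functor.map_comp]
    exact MorphismProperty.comp_mem _ _ _ (hf X) (hg X)

lemma repIsofib_of_isIso {A B : K} (f : A ⟶ B) [IsIso f] : repIsofib K f := by
  rw [repIsofib_iff]
  intro X
  exact MorphismProperty.rlp_of_isIso _ _

instance : (repIsofib K).IsStableUnderRetracts where
  of_retract h hg := by
    rw [repIsofib_iff] at *
    intro X
    exact MorphismProperty.of_retract (h.map (eCoyoneda SSet.{v} X)) (hg X)

end RepresentableIsofibrations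

/-! ### 2-categorical limits are simplicially enriched limits -/

section TwoLimits

open Bicategory Limits Enriched

variable {K : Type u} [Bicategory.{v, v} K] [Bicategory.Strict K]

/-- The cone `c` is a 2-categorical limit cone: besides being a limit cone in the underlying
category, it is universal with respect to 2-cells. -/
structure IsTwoLimit {J : Type*} [Category* J] {F : J ⥤ K} (c : Cone F) : Prop where
  one_dim : Nonempty (IsLimit c)
  two_dim : ∀ {X : K} (a b : X ⟶ c.pt) (β : ∀ j, a ≫ c.π.app j ⟶ b ≫ c.π.app j),
    (∀ {i j : J} (φ : i ⟶ j), HEq (β i ▷ F.map φ) (β j)) →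
    ∃! γ : a ⟶ b, ∀ j, γ ▷ c.π.app j = β j

namespace IsTwoLimit

variable {J : Type*} [Category* J] {F : J ⥤ K} {c : Cone F}

lemma whiskerRight_w (c : Cone F) {X : K} {a b : X ⟶ c.pt} (γ : a ⟶ b) {i j : J} (φ : i ⟶ j) :
    HEq (γ ▷ c.π.app i ▷ F.map φ) (γ ▷ c.π.app j) := by
  rw [← c.w φ]
  exact (whiskerRight_comp_heq _ _ _).symm

lemma cell_ext (h : IsTwoLimit c) {X : K} {a b : X ⟶ c.pt} {γ γ' : a ⟶ b}
    (hγ : ∀ j, γ ▷ c.π.app j = γ' ▷ c.π.app j) : γ = γ' :=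
  (h.two_dim a b (fun j ↦ γ ▷ c.π.app j) (whiskerRight_w c γ)).unique (fun _ ↦ rfl)
    (fun j ↦ (hγ j).symm)

lemma isLimit_homCat (h : IsTwoLimit c) (X : K) : Nonempty (IsLimit ((homCat X).mapCone c)) := by
  obtain ⟨hc⟩ := h.one_dim
  let p (s : Cone (F ⋙ homCat X)) (j : J) : s.pt ⥤ (X ⟶ F.obj j) := (s.π.app j).toFunctor
  have hp (s : Cone (F ⋙ homCat X)) {i j : J} (φ : i ⟶ j) :
      p s i ⋙ postcomp X (F.map φ) = p s j :=
    congrArg (·.toFunctor) (s.w φ)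
  let o (s : Cone (F ⋙ homCat X)) (x : s.pt) : X ⟶ c.pt :=
    hc.lift ⟨X, { app := fun j ↦ (p s j).obj x
                  naturality := fun i j φ ↦ by
                    refine (Category.id_comp _).trans ?_
                    exact (congrArg (fun G : s.pt ⥤ (X ⟶ F.obj j) ↦ G.obj x) (hp s φ)).symm }⟩
  have ho (s : Cone (F ⋙ homCat X)) (x : s.pt) (j : J) : o s x ≫ c.π.app j = (p s j).obj x :=
    hc.fac _ _
  have hm (s : Cone (F ⋙ homCat X)) {x y : s.pt} (m : x ⟶ y) :
      ∃ γ : o s x ⟶ o s y, ∀ j, HEq (γ ▷ c.π.app j) ((p s j).map m) := by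
    obtain ⟨γ, hγ, -⟩ := h.two_dim (o s x) (o s y)
      (fun j ↦ eqToHom (ho s x j) ≫ (p s j).map m ≫ eqToHom (ho s y j).symm) (fun {i j} φ ↦ by
        have : HEq ((p s i).map m ▷ F.map φ) ((p s j).map m) := by
          rw [← hp s φ]
          rfl
        refine HEq.trans ?_ (this.trans ?_)
        · exact whiskerRight_heq (ho s x i) (ho s y i) (by simp) _
        · simp)
    exact ⟨γ, fun j ↦ by rw [hγ]; simp⟩
  choose m hm using hm
  have mext (s : Cone (F ⋙ homCat X)) {x y : s.pt} (f : x ⟶ y) (γ : o s x ⟶ o s y)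
      (hγ : ∀ j, HEq (γ ▷ c.π.app j) ((p s j).map f)) : γ = m s f :=
    h.cell_ext (fun j ↦ eq_of_heq ((hγ j).trans (hm s f j).symm))
  let L (s : Cone (F ⋙ homCat X)) : s.pt ⥤ (X ⟶ c.pt) :=
    { obj := o s
      map := fun f ↦ m s f
      map_id := fun x ↦ (mext s _ _ (fun j ↦ by
        rw [id_whiskerRight]
        exact (id_heq_id (ho s x j)).trans (heq_of_eq ((p s j).map_id x).symm))).symm
      map_comp := fun {x y z} f g ↦ (mext s _ _ (fun j ↦ by
        rw [comp_whiskerRight, Functor.map_comp]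
        exact comp_heq_comp (ho s x j) (ho s y j) (ho s z j) (hm s f j) (hm s g j))).symm }
  refine ⟨⟨fun s ↦ (L s).toCatHom, fun s j ↦ ?_, fun s M hM ↦ ?_⟩⟩
  · ext1
    exact Functor.hext (fun x ↦ ho s x j) (fun x y f ↦ hm s f j)
  · ext1
    have hM' (j : J) : M.toFunctor ⋙ postcomp X (c.π.app j) = p s j :=
      congrArg (·.toFunctor) (hM j)
    have hobj (x : s.pt) : M.toFunctor.obj x = o s x := hc.hom_ext fun j ↦
      (congrArg (fun G : s.pt ⥤ (X ⟶ F.obj j) ↦ G.obj x) (hM' j)).trans (ho s x j).symm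
    refine Functor.hext hobj (fun x y f ↦ ?_)
    have := mext s f (eqToHom (hobj x).symm ≫ M.toFunctor.map f ≫ eqToHom (hobj y))
      (fun j ↦ by
        have h₁ : HEq ((M.toFunctor.map f) ▷ c.π.app j) ((p s j).map f) := by
          rw [← hM' j]
          rfl
        refine HEq.trans ?_ h₁
        exact whiskerRight_heq (hobj x).symm (hobj y).symm (eqToHom_conj_heq _ _ _) _)
    change HEq _ (m s f)
    rw [← this]
    exact (eqToHom_conj_heq _ _ _).symm

instance : PreservesLimitsOfSize nerveFunctor.{v, v} := nerveAdjunction.rightAdjoint_preservesLimits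

/-- 2-categorical limits are limits in the simplicially enriched sense, since taking nerves
preserves limits. -/
lemma hasConicalLimit (h : IsTwoLimit c) : HasConicalLimit SSet.{v} F where
  exists_limit := ⟨⟨c, h.one_dim.some⟩⟩
  preservesLimit_eCoyoneda X := by
    have : PreservesLimit F (homCat X) :=
      preservesLimit_of_preserves_limit_cone h.one_dim.some (h.isLimit_homCat X).some
    exact preservesLimit_of_natIso F (eCoyonedaIso X).symm

end IsTwoLimit

end TwoLimits

/-! ### Stability of representable isofibrations, and products -/

section RlpTower

open Limits Opposite

variable {C : Type*} [Category* C]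

/-- In a tower of morphisms with the right lifting property, lifts can be chosen successively. -/
lemma rlp_π_zero_of_tower (T : MorphismProperty C) (F : ℕᵒᵖ ⥤ C)
    (hF : ∀ n : ℕ, T.rlp (F.map (homOfLE (Nat.le_succ n)).op)) {c : Cone F} (hc : IsLimit c) :
    T.rlp (c.π.app (op 0)) := by
  intro A B i hi
  refine ⟨fun {t b} sq ↦ ?_⟩
  have step (n : ℕ) (l : B ⟶ F.obj (op n)) (hl : i ≫ l = t ≫ c.π.app (op n)) :
      ∃ l' : B ⟶ F.obj (op (n + 1)), i ≫ l' = t ≫ c.π.app (op (n + 1)) ∧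
        l' ≫ F.map (homOfLE (Nat.le_succ n)).op = l := by
    have sq' : CommSq (t ≫ c.π.app (op (n + 1))) i (F.map (homOfLE (Nat.le_succ n)).op) l :=
      ⟨by rw [Category.assoc, c.w, hl]⟩
    have := hF n i hi
    exact ⟨sq'.lift, sq'.fac_left, sq'.fac_right⟩
  choose next hnext hnext' using step
  let L (n : ℕ) : { l : B ⟶ F.obj (op n) // i ≫ l = t ≫ c.π.app (op n) } :=
    Nat.rec ⟨b, sq.w.symm⟩ (fun n l ↦ ⟨next n l.1 l.2, hnext n l.1 l.2⟩) n
  let s : Cone F := ⟨B, NatTrans.ofOpSequence (F := (Functor.const _).obj B) (fun n ↦ (L n).1)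
    (fun n ↦ (Category.id_comp _).trans (hnext' n (L n).1 (L n).2).symm)⟩
  refine ⟨⟨⟨hc.lift s, hc.hom_ext fun j ↦ ?_, hc.fac s (op 0)⟩⟩⟩
  rw [Category.assoc, hc.fac]
  exact (L j.unop).2

end RlpTower

section Stability

open Bicategory Limits Enriched Opposite

variable {K : Type u} [Bicategory.{v, v} K] [Bicategory.Strict K]

lemma repIsofib_of_isPullback {A B A' B' : K} {f' : A' ⟶ A} {p' : A' ⟶ B'} {p : A ⟶ B}
    {f : B' ⟶ B} (sq : IsPullback f' p' p f) [HasConicalPullback SSet.{v} p f]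
    (hp : repIsofib K p) : repIsofib K p' := by
  rw [repIsofib_iff] at *
  exact fun X ↦ MorphismProperty.of_isPullback (sq.map (eCoyoneda SSet.{v} X)) (hp X)

lemma repIsofib_isStableUnderProducts (J : Type v)
    [HasConicalLimitsOfShape (Discrete J) SSet.{v} K] :
    (repIsofib K).IsStableUnderLimitsOfShape (Discrete J) where
  condition X₁ X₂ c₁ c₂ h₁ h₂ f hf φ hφ := by
    rw [repIsofib_iff]
    intro X
    refine MorphismProperty.IsStableUnderLimitsOfShape.condition (J := Discrete J)
      (X₁ ⋙ eCoyoneda SSet.{v} X) (X₂ ⋙ eCoyoneda SSet.{v} X) ((eCoyoneda SSet.{v} X).mapCone c₁)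
      ((eCoyoneda SSet.{v} X).mapCone c₂) (isLimitOfPreserves _ h₁) (isLimitOfPreserves _ h₂)
      (Functor.whiskerRight f _) (fun j ↦ (repIsofib_iff _).1 (hf j) X) _ (fun j ↦ ?_)
    exact ((eCoyoneda SSet.{v} X).map_comp _ _).symm.trans
      ((congrArg (eCoyoneda SSet.{v} X).map (hφ j)).trans ((eCoyoneda SSet.{v} X).map_comp _ _))

lemma repIsofib_tower_π_zero (F : ℕᵒᵖ ⥤ K) (hF : IsTowerOf (repIsofib K) F)
    [HasConicalLimit SSet.{v} F] {c : Cone F} (hc : IsLimit c) : repIsofib K (c.π.app (op 0)) := by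
  rw [repIsofib_iff]
  exact fun X ↦ rlp_π_zero_of_tower sourceInclusion (F ⋙ eCoyoneda SSet.{v} X)
    (fun n ↦ (repIsofib_iff _).1 (hF n) X) (isLimitOfPreserves (eCoyoneda SSet.{v} X) hc)

lemma edge_comp_nerveMap {C D : Type v} [SmallCategory C] [SmallCategory D] {a b : C} (f : a ⟶ b)
    (F : C ⥤ D) :
    (SSet.yonedaEquiv (X := nerve C) (n := .mk 1)).symm (ComposableArrows.mk₁ f) ≫ nerveMap F =
      (SSet.yonedaEquiv (X := nerve D) (n := .mk 1)).symm (ComposableArrows.mk₁ (F.map f)) := by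
  apply SSet.yonedaEquiv.injective
  exact (nerveMap_app_mk₁ _ _).trans (Equiv.apply_symm_apply _ _).symm

/-- An arrow in the hom-category into a conical limit is determined by its components. -/
lemma arrow_ext_of_isLimit {J : Type*} [Category* J] {F : J ⥤ K} [HasConicalLimit SSet.{v} F]
    {c : Cone F} (hc : IsLimit c) {X : K} {γ γ' : Arrow (X ⟶ c.pt)}
    (h : ∀ j, (postcomp X (c.π.app j)).mapArrow.obj γ = (postcomp X (c.π.app j)).mapArrow.obj γ') :
    γ = γ' := by
  obtain ⟨a, b, γ⟩ := γ
  obtain ⟨a', b', γ'⟩ := γ'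
  have key : (SSet.yonedaEquiv (X := nerve (X ⟶ c.pt)) (n := .mk 1)).symm (ComposableArrows.mk₁ γ) =
      (SSet.yonedaEquiv (X := nerve (X ⟶ c.pt)) (n := .mk 1)).symm (ComposableArrows.mk₁ γ') := by
    refine (isLimitOfPreserves (eCoyoneda SSet.{v} X) hc).hom_ext fun j ↦ ?_
    change _ ≫ eHomWhiskerLeft SSet.{v} X _ = _ ≫ eHomWhiskerLeft SSet.{v} X _
    rw [eHomWhiskerLeft_eq, edge_comp_nerveMap, edge_comp_nerveMap]
    exact congrArg (fun f : Arrow (X ⟶ F.obj j) ↦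
      (SSet.yonedaEquiv (X := nerve (X ⟶ F.obj j)) (n := .mk 1)).symm
        (ComposableArrows.mk₁ f.hom)) (h j)
  have := (SSet.yonedaEquiv (X := nerve (X ⟶ c.pt)) (n := .mk 1)).symm.injective key
  exact congrArg (fun H : ComposableArrows (X ⟶ c.pt) 1 ↦ Arrow.mk H.hom) this

end Stability

section Products

open Bicategory Limits Enriched

variable {K : Type u} [Bicategory.{v, v} K] [Bicategory.Strict K]

lemma IsTwoProduct.cell_ext {J : Type v} {A : J → K} {P : K} {π : ∀ j, P ⟶ A j}
    (h : IsTwoProduct π) {X : K} {a b : X ⟶ P} {γ γ' : a ⟶ b} (hγ : ∀ j, γ ▷ π j = γ' ▷ π j) :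
    γ = γ' :=
  (h.two_dim a b (fun j ↦ γ ▷ π j)).unique (fun _ ↦ rfl) (fun j ↦ (hγ j).symm)

lemma IsTwoProduct.hom_ext {J : Type v} {A : J → K} {P : K} {π : ∀ j, P ⟶ A j}
    (h : IsTwoProduct π) {X : K} {a b : X ⟶ P} (hab : ∀ j, a ≫ π j = b ≫ π j) : a = b :=
  (h.one_dim (fun j ↦ a ≫ π j)).unique (fun _ ↦ rfl) (fun j ↦ (hab j).symm)

lemma IsTwoProduct.isTwoLimit {J : Type v} {F : Discrete J ⥤ K} {P : K}
    {π : ∀ j : J, P ⟶ F.obj ⟨j⟩} (h : IsTwoProduct π) :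
    IsTwoLimit (F := F) (⟨P, Discrete.natTrans (fun j ↦ π j.as)⟩ : Cone F) where
  one_dim := by
    choose l hl using fun (X : K) (f : ∀ j, X ⟶ F.obj ⟨j⟩) ↦ (h.one_dim f).exists
    exact ⟨⟨fun s ↦ l s.pt (fun j ↦ s.π.app ⟨j⟩), fun s j ↦ hl _ _ j.as,
      fun s m hm ↦ h.hom_ext fun j ↦ (hm ⟨j⟩).trans (hl s.pt (fun j ↦ s.π.app ⟨j⟩) j).symm⟩⟩
  two_dim a b β _ := by
    obtain ⟨γ, hγ, hu⟩ := h.two_dim a b (fun j ↦ β ⟨j⟩)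
    exact ⟨γ, fun j ↦ hγ j.as, fun γ' hγ' ↦ hu γ' fun j ↦ hγ' ⟨j⟩⟩

lemma HasFlexibleLimits.hasConicalProducts (h : HasFlexibleLimits K) :
    HasConicalProducts.{v} SSet.{v} K where
  hasConicalLimitsOfShape J :=
    ⟨fun F ↦ by
      obtain ⟨P, π, hπ⟩ := h.products (fun j : J ↦ F.obj ⟨j⟩)
      exact hπ.isTwoLimit.hasConicalLimit⟩

end Products

/-! ### Universal actions of a category -/

section UniversalActions

open Bicategory

variable {K : Type u} [Bicategory.{v, v} K] [Bicategory.Strict K]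

lemma IsTwoProduct.cell_hext {J : Type v} {A : J → K} {P : K} {π : ∀ j, P ⟶ A j}
    (h : IsTwoProduct π) {X : K} {a b a' b' : X ⟶ P} {γ : a ⟶ b} {γ' : a' ⟶ b'} (ha : a = a')
    (hb : b = b') (hγ : ∀ j, HEq (γ ▷ π j) (γ' ▷ π j)) : HEq γ γ' := by
  subst ha hb
  exact heq_of_eq (h.cell_ext fun j ↦ eq_of_heq (hγ j))

/-- `p` is universal among the 1-cells that equify each of the pairs of 2-cells `σ j, τ j`. -/
structure IsJointEquifier {J : Type v} {A B : K} {f g : J → (A ⟶ B)} (σ τ : ∀ j, f j ⟶ g j)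
    {E : K} (p : E ⟶ A) : Prop where
  equifies : ∀ j, p ◁ σ j = p ◁ τ j
  one_dim : ∀ {X : K} (a : X ⟶ A), (∀ j, a ◁ σ j = a ◁ τ j) → ∃! u : X ⟶ E, u ≫ p = a
  two_dim : ∀ {X : K} (u u' : X ⟶ E) (β : u ≫ p ⟶ u' ≫ p), ∃! γ : u ⟶ u', γ ▷ p = β

lemma HasFlexibleLimits.exists_jointEquifier (h : HasFlexibleLimits K) {J : Type v} {A B : K}
    {f g : J → (A ⟶ B)} (σ τ : ∀ j, f j ⟶ g j) :
    ∃ (E : K) (p : E ⟶ A), IsJointEquifier σ τ p := by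
  obtain ⟨Q, π, hQ⟩ := h.products (fun _ : J ↦ B)
  obtain ⟨F, hF, -⟩ := hQ.one_dim f
  obtain ⟨G, hG, -⟩ := hQ.one_dim g
  have key (ρ : ∀ j, f j ⟶ g j) : ∃ ρ' : F ⟶ G, ∀ j, HEq (ρ' ▷ π j) (ρ j) := by
    obtain ⟨ρ', hρ', -⟩ := hQ.two_dim F G (fun j ↦ eqToHom (hF j) ≫ ρ j ≫ eqToHom (hG j).symm)
    exact ⟨ρ', fun j ↦ by rw [hρ']; exact eqToHom_conj_heq _ _ _⟩
  obtain ⟨σ', hσ⟩ := key σ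
  obtain ⟨τ', hτ⟩ := key τ
  have whisker {X : K} (a : X ⟶ A) (ρ : ∀ j, f j ⟶ g j) (ρ' : F ⟶ G)
      (hρ : ∀ j, HEq (ρ' ▷ π j) (ρ j)) (j : J) : HEq ((a ◁ ρ') ▷ π j) (a ◁ ρ j) :=
    (whisker_assoc_heq _ _ _).trans (whiskerLeft_heq (hF j) (hG j) (hρ j) a)
  obtain ⟨E, p, hE⟩ := h.equifiers σ' τ'
  refine ⟨E, p, fun j ↦ ?_, fun a ha ↦ hE.one_dim a ?_, hE.two_dim⟩
  · refine eq_of_heq ((whisker p σ σ' hσ j).symm.trans ?_)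
    rw [hE.equifies]
    exact whisker p τ τ' hτ j
  · exact hQ.cell_ext fun j ↦ eq_of_heq ((whisker a σ σ' hσ j).trans
      ((heq_of_eq (ha j)).trans (whisker a τ τ' hτ j).symm))

variable {D : Type v} [SmallCategory D]

/-- Given a family of 1-cells `a d : A ⟶ B` indexed by the objects of a category `D`, the 1-cell
`p : P ⟶ A` is universal among those equipped with an extension of `d ↦ p ≫ a d` to a functor
`D ⥤ (P ⟶ B)`, whose action on morphisms is `l`. If `D` is the free-living isomorphism, this is the
universal invertible 2-cell between `p ≫ a 0` and `p ≫ a 1`; if `A` is the product of copies of `B`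
indexed by the objects of `D`, this is the power of `B` by `D`. -/
structure IsUniversalAction {A B P : K} (a : D → (A ⟶ B)) (p : P ⟶ A)
    (l : ∀ {c d : D}, (c ⟶ d) → (p ≫ a c ⟶ p ≫ a d)) : Prop where
  map_id : ∀ d, l (𝟙 d) = 𝟙 _
  map_comp : ∀ {c d e : D} (φ : c ⟶ d) (ψ : d ⟶ e), l (φ ≫ ψ) = l φ ≫ l ψ
  exists_lift : ∀ {X : K} (x : X ⟶ A) (m : ∀ {c d : D}, (c ⟶ d) → (x ≫ a c ⟶ x ≫ a d)),
    (∀ d, m (𝟙 d) = 𝟙 _) → (∀ {c d e : D} (φ : c ⟶ d) (ψ : d ⟶ e), m (φ ≫ ψ) = m φ ≫ m ψ) →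
    ∃ u : X ⟶ P, u ≫ p = x ∧ ∀ {c d : D} (φ : c ⟶ d), HEq (u ◁ l φ) (m φ)
  hom_ext : ∀ {X : K} {u u' : X ⟶ P}, u ≫ p = u' ≫ p →
    (∀ {c d : D} (φ : c ⟶ d), HEq (u ◁ l φ) (u' ◁ l φ)) → u = u'
  two_dim : ∀ {X : K} (u u' : X ⟶ P) (β : u ≫ p ⟶ u' ≫ p),
    (∀ {c d : D} (φ : c ⟶ d),
      restrictCell (l φ) u ≫ β ▷ a d = β ▷ a c ≫ restrictCell (l φ) u') →
    ∃! γ : u ⟶ u', γ ▷ p = β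

lemma HasFlexibleLimits.exists_universalAction (h : HasFlexibleLimits K) {A B : K}
    (a : D → (A ⟶ B)) :
    ∃ (P : K) (p : P ⟶ A) (l : ∀ {c d : D}, (c ⟶ d) → (p ≫ a c ⟶ p ≫ a d)),
      IsUniversalAction a p l := by
  obtain ⟨Q, π, hQ⟩ := h.products (fun _ : Σ c d : D, c ⟶ d ↦ B)
  obtain ⟨F, hF, -⟩ := hQ.one_dim (fun s ↦ a s.1)
  obtain ⟨G, hG, -⟩ := hQ.one_dim (fun s ↦ a s.2.1)
  have assocF {X : K} (x : X ⟶ A) (s : Σ c d : D, c ⟶ d) : (x ≫ F) ≫ π s = x ≫ a s.1 := by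
    rw [Strict.assoc, hF]
  have assocG {X : K} (x : X ⟶ A) (s : Σ c d : D, c ⟶ d) : (x ≫ G) ≫ π s = x ≫ a s.2.1 := by
    rw [Strict.assoc, hG]
  obtain ⟨I, i, t, hI⟩ := h.inserters F G
  -- The components of the universal 2-cell `t`.
  let l₀ {c d : D} (φ : c ⟶ d) : i ≫ a c ⟶ i ≫ a d :=
    eqToHom (assocF i ⟨c, d, φ⟩).symm ≫ t ▷ π ⟨c, d, φ⟩ ≫ eqToHom (assocG i ⟨c, d, φ⟩)
  have hl₀ {c d : D} (φ : c ⟶ d) : HEq (l₀ φ) (t ▷ π ⟨c, d, φ⟩) := eqToHom_conj_heq _ _ _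
  have hl₀' {X : K} (u : X ⟶ I) {c d : D} (φ : c ⟶ d) :
      HEq (u ◁ l₀ φ) ((u ◁ t) ▷ π ⟨c, d, φ⟩) :=
    (whiskerLeft_heq (assocF i ⟨c, d, φ⟩).symm (assocG i ⟨c, d, φ⟩).symm (hl₀ φ) u).trans
      (whisker_assoc_heq _ _ _).symm
  have hr {X : K} (u : X ⟶ I) {c d : D} (φ : c ⟶ d) :
      HEq (restrictCell t u ▷ π ⟨c, d, φ⟩) (u ◁ l₀ φ) :=
    (whiskerRight_heq (Strict.assoc _ _ _) (Strict.assoc _ _ _) (restrictCell_heq t u) _).trans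
      (hl₀' u φ).symm
  have lift₀ {X : K} (x : X ⟶ A) (m : ∀ {c d : D}, (c ⟶ d) → (x ≫ a c ⟶ x ≫ a d)) :
      ∃ u : X ⟶ I, u ≫ i = x ∧ ∀ {c d : D} (φ : c ⟶ d), HEq (u ◁ l₀ φ) (m φ) := by
    obtain ⟨α, hα, -⟩ := hQ.two_dim (x ≫ F) (x ≫ G) (fun s ↦
      eqToHom (assocF x s) ≫ m s.2.2 ≫ eqToHom (assocG x s).symm)
    obtain ⟨u, ⟨hu, hu'⟩, -⟩ := hI.one_dim x α
    subst hu
    refine ⟨u, rfl, fun {c d} φ ↦ (hr u φ).symm.trans ?_⟩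
    have : restrictCell t u = α := by simpa using hu'
    rw [this, hα]
    exact eqToHom_conj_heq _ _ _
  have ext₀ {X : K} {u u' : X ⟶ I} (huu : u ≫ i = u' ≫ i)
      (hl : ∀ {c d : D} (φ : c ⟶ d), HEq (u ◁ l₀ φ) (u' ◁ l₀ φ)) : u = u' := by
    refine (hI.one_dim (u' ≫ i) (restrictCell t u')).unique ⟨huu, ?_⟩ ⟨rfl, by simp⟩
    have : HEq (restrictCell t u) (restrictCell t u') :=
      hQ.cell_hext (by rw [huu]) (by rw [huu])
        (fun s ↦ (hr u s.2.2).trans ((hl s.2.2).trans (hr u' s.2.2).symm))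
    refine eq_of_heq (HEq.trans ?_ (this.trans ?_))
    · simp
    · simp
  -- Functoriality is imposed by an equifier.
  let T := (f : I ⟶ B) × (g : I ⟶ B) × (f ⟶ g) × (f ⟶ g)
  let e : (D ⊕ Σ c d e : D, (c ⟶ d) × (d ⟶ e)) → T :=
    Sum.elim (fun d ↦ ⟨_, _, l₀ (𝟙 d), 𝟙 _⟩)
      (fun s ↦ ⟨_, _, l₀ (s.2.2.2.1 ≫ s.2.2.2.2), l₀ s.2.2.2.1 ≫ l₀ s.2.2.2.2⟩)
  obtain ⟨E, q, hE⟩ := h.exists_jointEquifier (f := fun j ↦ (e j).1) (g := fun j ↦ (e j).2.1)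
    (fun j ↦ (e j).2.2.1) (fun j ↦ (e j).2.2.2)
  have hid (d : D) : q ◁ l₀ (𝟙 d) = q ◁ 𝟙 _ := hE.equifies (Sum.inl d)
  have hcomp {c d e : D} (φ : c ⟶ d) (ψ : d ⟶ e) : q ◁ l₀ (φ ≫ ψ) = q ◁ (l₀ φ ≫ l₀ ψ) :=
    hE.equifies (Sum.inr ⟨c, d, e, φ, ψ⟩)
  have hlq {X : K} (u : X ⟶ E) {c d : D} (φ : c ⟶ d) :
      HEq (u ◁ restrictCell (l₀ φ) q) ((u ≫ q) ◁ l₀ φ) :=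
    (whiskerLeft_heq (Strict.assoc _ _ _) (Strict.assoc _ _ _) (restrictCell_heq _ _) _).trans
      (comp_whiskerLeft_heq _ _ _).symm
  refine ⟨E, q ≫ i, fun φ ↦ restrictCell (l₀ φ) q, ?_, ?_, ?_, ?_, ?_⟩
  · intro d
    simp [restrictCell, hid]
  · intro c d e φ ψ
    simp [restrictCell, hcomp]
  · intro X x m m_id m_comp
    obtain ⟨u, rfl, hu⟩ := lift₀ x m
    have hum {c d : D} (φ : c ⟶ d) : HEq (m φ) (u ◁ l₀ φ) := (hu φ).symm
    obtain ⟨w, rfl, -⟩ := hE.one_dim u (by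
      rintro (d | ⟨c, d, e, φ, ψ⟩)
      · change u ◁ l₀ (𝟙 d) = u ◁ 𝟙 _
        refine eq_of_heq ((hu _).trans ?_)
        rw [m_id, whiskerLeft_id]
        exact id_heq_id (Strict.assoc _ _ _)
      · change u ◁ l₀ (φ ≫ ψ) = u ◁ (l₀ φ ≫ l₀ ψ)
        refine eq_of_heq ((hu _).trans ?_)
        rw [m_comp, whiskerLeft_comp]
        exact comp_heq_comp (Strict.assoc _ _ _) (Strict.assoc _ _ _) (Strict.assoc _ _ _)
          (hum _) (hum _))
    exact ⟨w, (Strict.assoc _ _ _).symm, fun φ ↦ (hlq w φ).trans (hu φ)⟩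
  · intro X u u' hu hl
    have : u ≫ q = u' ≫ q := by
      apply ext₀
      · rw [Strict.assoc, hu, Strict.assoc]
      · intro c d φ
        exact (hlq u φ).symm.trans ((hl φ).trans (hlq u' φ))
    exact (hE.one_dim (u' ≫ q) (fun j ↦ by
      rw [comp_whiskerLeft, comp_whiskerLeft, hE.equifies])).unique this rfl
  · intro X u u' β hβ
    have e₁ : (u ≫ q) ≫ i = u ≫ q ≫ i := Strict.assoc _ _ _
    have e₂ : (u' ≫ q) ≫ i = u' ≫ q ≫ i := Strict.assoc _ _ _
    have hlq' {u : X ⟶ E} (s : Σ c d : D, c ⟶ d) :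
        HEq (restrictCell t (u ≫ q) ▷ π s) (restrictCell (restrictCell (l₀ s.2.2) q) u) :=
      (hr (u ≫ q) s.2.2).trans ((hlq u s.2.2).symm.trans (restrictCell_heq _ _).symm)
    let β' : (u ≫ q) ≫ i ⟶ (u' ≫ q) ≫ i := eqToHom e₁ ≫ β ≫ eqToHom e₂.symm
    have hβ' : HEq β' β := eqToHom_conj_heq _ _ _
    have hβF (f : A ⟶ Q) (b : A ⟶ B) (s : Σ c d : D, c ⟶ d) (hf : f ≫ π s = b) :
        HEq (β' ▷ f ▷ π s) (β ▷ b) := by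
      subst hf
      exact (whiskerRight_comp_heq _ _ _).symm.trans (whiskerRight_heq e₁ e₂ hβ' _)
    have hF' (u : X ⟶ E) (s : Σ c d : D, c ⟶ d) :
        (((u ≫ q) ≫ i) ≫ F) ≫ π s = (u ≫ q ≫ i) ≫ a s.1 := by
      rw [assocF, Strict.assoc u]
    have hG' (u : X ⟶ E) (s : Σ c d : D, c ⟶ d) :
        (((u ≫ q) ≫ i) ≫ G) ≫ π s = (u ≫ q ≫ i) ≫ a s.2.1 := by
      rw [assocG, Strict.assoc u]
    obtain ⟨γ₀, hγ₀, hγ₀'⟩ := hI.two_dim (u ≫ q) (u' ≫ q) β' (by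
      refine hQ.cell_ext fun s ↦ ?_
      rw [comp_whiskerRight (restrictCell t (u ≫ q)), comp_whiskerRight (β' ▷ F)]
      refine eq_of_heq (HEq.trans ?_ ((heq_of_eq (hβ s.2.2)).trans ?_))
      · exact comp_heq_comp (hF' u s) (hG' u s) (hG' u' s) (hlq' s) (hβF _ _ _ (hG s))
      · exact (comp_heq_comp (hF' u s) (hF' u' s) (hG' u' s) (hβF _ _ _ (hF s)) (hlq' s)).symm)
    obtain ⟨γ, hγ, hγ'⟩ := hE.two_dim u u' γ₀
    refine ⟨γ, eq_of_heq ?_, fun δ hδ ↦ hγ' δ (hγ₀' _ (eq_of_heq ?_))⟩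
    · refine (whiskerRight_comp_heq _ _ _).trans ?_
      rw [hγ, hγ₀]
      exact hβ'
    · refine (whiskerRight_comp_heq _ _ _).symm.trans ?_
      rw [hδ]
      exact hβ'.symm

end UniversalActions

/-! ### Iso-inserters and strictification of equalizers -/

section IsoInserters

open Bicategory

variable {K : Type u} [Bicategory.{v, v} K] [Bicategory.Strict K]

/-- `(M, p, l)` is an iso-inserter of the parallel pair `f, g : A ⟶ B`: the universal 1-cell `p`
into `A` equipped with an invertible 2-cell `l : p ≫ f ≅ p ≫ g`. -/
structure IsIsoInserter {A B M : K} {f g : A ⟶ B} (p : M ⟶ A) (l : p ≫ f ≅ p ≫ g) : Prop where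
  exists_lift : ∀ {X : K} (x : X ⟶ A) (α : x ≫ f ≅ x ≫ g),
    ∃ u : X ⟶ M, u ≫ p = x ∧ HEq (u ◁ l.hom) α.hom
  hom_ext : ∀ {X : K} {u u' : X ⟶ M}, u ≫ p = u' ≫ p → HEq (u ◁ l.hom) (u' ◁ l.hom) → u = u'
  two_dim : ∀ {X : K} (u u' : X ⟶ M) (β : u ≫ p ⟶ u' ≫ p),
    restrictCell l.hom u ≫ β ▷ g = β ▷ f ≫ restrictCell l.hom u' → ∃! γ : u ⟶ u', γ ▷ p = β

lemma HasFlexibleLimits.exists_isoInserter (h : HasFlexibleLimits K) {A B : K} (f g : A ⟶ B) :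
    ∃ (M : K) (p : M ⟶ A) (l : p ≫ f ≅ p ≫ g), IsIsoInserter p l := by
  let D := ULiftHom.{v} WalkingIso.{v}
  let z : D := ULiftHom.objUp .zero
  let o : D := ULiftHom.objUp .one
  let i : z ≅ o := ULiftHom.up.mapIso WalkingIso.iso
  let a : D → (A ⟶ B) := fun d ↦ bif d.objDown.as.down then g else f
  obtain ⟨M, p, l, hl⟩ := h.exists_universalAction a
  let l' : p ≫ f ≅ p ≫ g := ⟨l i.hom, l i.inv,
    (hl.map_comp i.hom i.inv).symm.trans ((congrArg l i.hom_inv_id).trans (hl.map_id z)),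
    (hl.map_comp i.inv i.hom).symm.trans ((congrArg l i.inv_hom_id).trans (hl.map_id o))⟩
  have cases_hom {P : ∀ {c d : D}, (c ⟶ d) → Prop} (h₀ : P (𝟙 z)) (h₁ : P (𝟙 o)) (h₂ : P i.hom)
      (h₃ : P i.inv) {c d : D} (φ : c ⟶ d) : P φ := by
    obtain ⟨⟨⟩⟩ := φ
    obtain ⟨⟨_ | _⟩⟩ := c <;> obtain ⟨⟨_ | _⟩⟩ := d
    exacts [h₀, h₂, h₃, h₁]
  refine ⟨M, p, l', fun {X} x α ↦ ?_, fun {X u u'} hu huu' ↦ hl.hom_ext hu fun φ ↦ ?_,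
    fun {X} u u' β hβ ↦ hl.two_dim u u' β ?_⟩
  · let G : D ⥤ (X ⟶ B) := ULiftHom.down ⋙ WalkingIso.fromIso α
    have hG (d : D) : G.obj d = x ≫ a d := by
      obtain ⟨⟨_ | _⟩⟩ := d <;> rfl
    obtain ⟨u, hu, hu'⟩ := hl.exists_lift x
      (fun {c d} φ ↦ eqToHom (hG c).symm ≫ G.map φ ≫ eqToHom (hG d))
      (fun d ↦ by simp) (fun φ ψ ↦ by simp)
    exact ⟨u, hu, (hu' i.hom).trans (eqToHom_conj_heq _ _ _)⟩
  · have e₁ : u ≫ p ≫ f = u' ≫ p ≫ f := by rw [← Strict.assoc, hu, Strict.assoc]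
    have e₂ : u' ≫ p ≫ g = u ≫ p ≫ g := by rw [← Strict.assoc, ← hu, Strict.assoc]
    have key : whiskerLeftIso u l' = eqToIso e₁ ≪≫ whiskerLeftIso u' l' ≪≫ eqToIso e₂ := by
      ext
      exact eq_of_heq (huu'.trans (eqToHom_conj_heq (u' ◁ l'.hom) e₁ e₂).symm)
    refine cases_hom (P := fun φ ↦ HEq (u ◁ l φ) (u' ◁ l φ)) ?_ ?_ huu' ?_ φ
    · rw [hl.map_id, whiskerLeft_id, whiskerLeft_id]
      exact id_heq_id (by rw [← Strict.assoc, hu, Strict.assoc])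
    · rw [hl.map_id, whiskerLeft_id, whiskerLeft_id]
      exact id_heq_id (by rw [← Strict.assoc, hu, Strict.assoc])
    · have := congrArg Iso.inv key
      refine HEq.trans (heq_of_eq this) ?_
      simp only [Iso.trans_inv, eqToIso.inv, Category.assoc]
      exact eqToHom_conj_heq _ _ _
  · intro c d φ
    have hri (u : X ⟶ M) : restrictCell (l i.hom) u ≫ restrictCell (l i.inv) u = 𝟙 _ := by
      simp [restrictCell, ← whiskerLeft_comp_assoc, ← hl.map_comp, hl.map_id]
    have hri' (u : X ⟶ M) : restrictCell (l i.inv) u ≫ restrictCell (l i.hom) u = 𝟙 _ := by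
      simp [restrictCell, ← whiskerLeft_comp_assoc, ← hl.map_comp, hl.map_id]
    refine cases_hom (P := fun {c d} φ ↦
      restrictCell (l φ) u ≫ β ▷ a d = β ▷ a c ≫ restrictCell (l φ) u') ?_ ?_ hβ ?_ φ
    · simp [restrictCell, hl.map_id]
    · simp [restrictCell, hl.map_id]
    · have hβ' : restrictCell (l i.hom) u ≫ β ▷ a o = β ▷ a z ≫ restrictCell (l i.hom) u' := hβ
      have key {a b c d : X ⟶ B} {r : a ⟶ b} {r' : b ⟶ a} {s : c ⟶ d} {s' : d ⟶ c} {m : a ⟶ c}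
          {n : b ⟶ d} (hr : r' ≫ r = 𝟙 _) (hs : s ≫ s' = 𝟙 _) (h : r ≫ n = m ≫ s) :
          r' ≫ m = n ≫ s' := by
        calc r' ≫ m = r' ≫ (m ≫ s) ≫ s' := by rw [Category.assoc, hs, Category.comp_id]
          _ = n ≫ s' := by rw [← h, ← Category.assoc, ← Category.assoc, hr, Category.id_comp]
      exact key (hri' u) (hri u') hβ'

namespace IsIsoInserter

variable {A B M : K} {f g : A ⟶ B} {p : M ⟶ A} {l : p ≫ f ≅ p ≫ g}

lemma whiskerRight_compat (p : M ⟶ A) (l : p ≫ f ≅ p ≫ g) {X : K} {u u' : X ⟶ M} (γ : u ⟶ u') :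
    restrictCell l.hom u ≫ γ ▷ p ▷ g = γ ▷ p ▷ f ≫ restrictCell l.hom u' := by
  have := whisker_exchange γ l.hom
  simp only [whiskerRight_comp, Category.assoc] at this
  simp only [restrictCell, Category.assoc]
  rw [← cancel_epi (α_ u p f).inv, ← cancel_mono (α_ u' p g).hom]
  simpa using this

lemma cell_hext (h : IsIsoInserter p l) {X : K} {a b a' b' : X ⟶ M} {γ : a ⟶ b} {γ' : a' ⟶ b'}
    (ha : a = a') (hb : b = b') (hγ : HEq (γ ▷ p) (γ' ▷ p)) : HEq γ γ' := by
  subst ha hb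
  exact heq_of_eq ((h.two_dim a b (γ' ▷ p) (whiskerRight_compat p l γ')).unique (eq_of_heq hγ) rfl)

end IsIsoInserter

end IsoInserters

section Splittings

open Bicategory

variable {K : Type u} [Bicategory.{v, v} K] [Bicategory.Strict K]

/-- If the idempotent `r ≫ s` receives a 2-cell `t` from the identity that is an identity when
restricted along `r ≫ s`, then the splitting `s` is full and faithful. -/
lemma existsUnique_of_splitting {M P : K} {s : P ⟶ M} {r : M ⟶ P} (hsr : s ≫ r = 𝟙 P)
    (t : 𝟙 M ⟶ r ≫ s) (ht : HEq ((r ≫ s) ◁ t) (𝟙 (r ≫ s))) {X : K} (u w : X ⟶ P)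
    (γ : u ≫ s ⟶ w ≫ s) : ∃! δ : u ⟶ w, δ ▷ s = γ := by
  have hs : s ≫ r ≫ s = s := by rw [← Strict.assoc, hsr, Strict.id_comp]
  have hee : (r ≫ s) ≫ r ≫ s = r ≫ s := by rw [Strict.assoc, hs]
  have hu (u : X ⟶ P) : (u ≫ s) ≫ r = u := by rw [Strict.assoc, hsr, Strict.comp_id]
  have hue (u : X ⟶ P) : (u ≫ s) ≫ (r ≫ s) = u ≫ s := by rw [Strict.assoc, hs]
  have ht' (u : X ⟶ P) : HEq ((u ≫ s) ◁ t) (𝟙 (u ≫ s)) := by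
    have h₁ : HEq ((u ≫ s) ◁ t) (((u ≫ s) ≫ (r ≫ s)) ◁ t) :=
      whiskerLeft_congr_heq (hue u).symm t
    refine h₁.trans ((comp_whiskerLeft_heq _ _ _).trans ?_)
    refine (whiskerLeft_heq (Strict.comp_id _) hee ht _).trans ?_
    rw [whiskerLeft_id]
    exact id_heq_id (hue u)
  have hγ : HEq (γ ▷ (r ≫ s)) γ := by
    have hx := whisker_exchange γ t
    have h₁ : HEq (γ ▷ 𝟙 M ≫ (w ≫ s) ◁ t) (γ ≫ 𝟙 _) :=
      comp_heq_comp (Strict.comp_id _) (Strict.comp_id _) (hue w) (whiskerRight_id_heq γ) (ht' w)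
    have h₂ : HEq ((u ≫ s) ◁ t ≫ γ ▷ (r ≫ s)) (𝟙 _ ≫ γ ▷ (r ≫ s)) :=
      comp_heq_comp ((Strict.comp_id _).trans (hue u).symm) rfl rfl
        ((ht' u).trans (id_heq_id (hue u).symm)) HEq.rfl
    rw [Category.id_comp] at h₂
    exact h₂.symm.trans ((heq_of_eq hx).trans (h₁.trans (heq_of_eq (Category.comp_id γ))))
  refine ⟨eqToHom (hu u).symm ≫ γ ▷ r ≫ eqToHom (hu w), eq_of_heq ?_, fun δ hδ ↦ eq_of_heq ?_⟩
  · exact (whiskerRight_heq (hu u).symm (hu w).symm (eqToHom_conj_heq _ _ _) s).trans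
      ((whiskerRight_comp_heq _ _ _).symm.trans hγ)
  · refine HEq.trans ?_ (eqToHom_conj_heq _ _ _).symm
    rw [← hδ]
    refine HEq.trans ?_ (whiskerRight_comp_heq _ _ _)
    rw [hsr]
    exact (whiskerRight_id_heq δ).symm

/-- `q` is a 2-categorical equalizer of `f, g : A ⟶ B`. -/
structure IsTwoEqualizer {A B P : K} (f g : A ⟶ B) (q : P ⟶ A) : Prop where
  w : q ≫ f = q ≫ g
  one_dim : ∀ {X : K} (x : X ⟶ A), x ≫ f = x ≫ g → ∃! u : X ⟶ P, u ≫ q = x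
  two_dim : ∀ {X : K} (u w : X ⟶ P) (β : u ≫ q ⟶ w ≫ q), HEq (β ▷ f) (β ▷ g) →
    ∃! γ : u ⟶ w, γ ▷ q = β

/-- The equalizer of `f` and `g` exists as soon as the universal invertible 2-cell
`l : p ≫ f ≅ p ≫ g` can be strictified, that is, `p` is replaced by an isomorphic 1-cell `p'` which
equalizes `f` and `g`, in a way that changes nothing where `l` is already an identity. The
equalizer is the splitting of an idempotent on the iso-inserter. -/
lemma HasFlexibleLimits.exists_twoEqualizer (h : HasFlexibleLimits K) {A B M : K} {f g : A ⟶ B}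
    {p : M ⟶ A} {l : p ≫ f ≅ p ≫ g} (hl : IsIsoInserter p l) (p' : M ⟶ A) (θ : p ⟶ p')
    (hp' : p' ≫ f = p' ≫ g) (hθ : HEq (l.hom ≫ θ ▷ g) (θ ▷ f))
    (hnormal : ∀ {X : K} (k : X ⟶ M), k ≫ p ≫ f = k ≫ p ≫ g →
      HEq (k ◁ l.hom) (𝟙 (k ≫ p ≫ f)) → k ≫ p' = k ≫ p ∧ HEq (k ◁ θ) (𝟙 (k ≫ p))) :
    ∃ (P : K) (q : P ⟶ A), IsTwoEqualizer f g q := by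
  obtain ⟨e, hep, hel⟩ := hl.exists_lift p' (eqToIso hp')
  have hef : e ≫ p ≫ f = p' ≫ f := by rw [← Strict.assoc, hep]
  have heg : e ≫ p ≫ g = p' ≫ g := by rw [← Strict.assoc, hep]
  have hfg : e ≫ p ≫ f = e ≫ p ≫ g := hef.trans (hp'.trans heg.symm)
  have eqToHom_heq {X Y : K} {a b c : X ⟶ Y} (hab : a = b) (hac : a = c) :
      HEq (eqToHom hab) (𝟙 c) := by
    subst hab hac
    rfl
  have hel' : HEq (e ◁ l.hom) (𝟙 (e ≫ p ≫ f)) := hel.trans (eqToHom_heq hp' hef.symm)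
  -- Restricting `l` along a 1-cell fixed by `e` gives an identity.
  have fixed {X : K} (k : X ⟶ M) : (k ≫ e) ≫ p ≫ f = (k ≫ e) ≫ p ≫ g ∧
      HEq ((k ≫ e) ◁ l.hom) (𝟙 ((k ≫ e) ≫ p ≫ f)) := by
    refine ⟨by rw [Strict.assoc, hfg, ← Strict.assoc], ?_⟩
    refine (comp_whiskerLeft_heq _ _ _).trans ((whiskerLeft_heq rfl hfg.symm hel' k).trans ?_)
    rw [whiskerLeft_id, Strict.assoc]
  have fixed_of {X : K} (k : X ⟶ M) (hk : k ≫ p ≫ f = k ≫ p ≫ g)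
      (hkl : HEq (k ◁ l.hom) (𝟙 (k ≫ p ≫ f))) : k ≫ e = k := by
    have h₁ : (k ≫ e) ≫ p = k ≫ p := by rw [Strict.assoc, hep, (hnormal k hk hkl).1]
    refine hl.hom_ext h₁ ((fixed k).2.trans (HEq.trans (id_heq_id ?_) hkl.symm))
    rw [← Strict.assoc, h₁, Strict.assoc]
  have hee : e ≫ e = e := fixed_of e hfg hel'
  -- The 2-cell from the identity to `e` with underlying 2-cell `θ`.
  have hβ : HEq (eqToHom (Strict.id_comp p) ≫ θ ≫ eqToHom hep.symm) θ := eqToHom_conj_heq _ _ _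
  obtain ⟨t, ht, -⟩ := hl.two_dim (𝟙 M) e (eqToHom (Strict.id_comp p) ≫ θ ≫ eqToHom hep.symm) (by
    have h₁ : (𝟙 M ≫ p) ≫ f = p ≫ f := by rw [Strict.id_comp]
    have h₂ : (𝟙 M ≫ p) ≫ g = p ≫ g := by rw [Strict.id_comp]
    have h₃ : (e ≫ p) ≫ g = p' ≫ g := by rw [hep]
    have h₄ : (e ≫ p) ≫ f = p' ≫ f := by rw [hep]
    refine eq_of_heq (HEq.trans (b := l.hom ≫ θ ▷ g) ?_ (hθ.trans ?_))
    · exact comp_heq_comp h₁ h₂ h₃ ((restrictCell_heq _ _).trans (id_whiskerLeft_heq _))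
        (whiskerRight_heq (Strict.id_comp p) hep hβ g)
    · have : HEq (θ ▷ f ≫ 𝟙 _) _ := comp_heq_comp h₁.symm h₄.symm (hp'.trans h₃.symm)
        (whiskerRight_heq (Strict.id_comp p).symm hep.symm hβ.symm f)
        ((eqToHom_heq hp' rfl).symm.trans (hel.symm.trans (restrictCell_heq l.hom e).symm))
      rwa [Category.comp_id] at this)
  have het : HEq (e ◁ t) (𝟙 e) := by
    refine hl.cell_hext (Strict.comp_id e) hee ?_
    refine (whisker_assoc_heq _ _ _).trans ?_
    rw [ht, id_whiskerRight]
    exact (whiskerLeft_heq (Strict.id_comp p) hep hβ e).trans (hnormal e hfg hel').2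
  obtain ⟨P, s, r, hsr, hrs⟩ := h.idempotents.idempotents_split M e hee
  subst hrs
  have hsr' : s ≫ r = 𝟙 P := hsr
  have hs : s ≫ r ≫ s = s := by rw [← Strict.assoc, hsr', Strict.id_comp]
  have hus {X : K} (u : X ⟶ P) : (u ≫ s) ≫ (r ≫ s) = u ≫ s := by rw [Strict.assoc, hs]
  have fixed_s {X : K} (u : X ⟶ P) : (u ≫ s) ≫ p ≫ f = (u ≫ s) ≫ p ≫ g ∧
      HEq ((u ≫ s) ◁ l.hom) (𝟙 ((u ≫ s) ≫ p ≫ f)) := by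
    have := fixed (u ≫ s)
    rwa [hus] at this
  refine ⟨P, s ≫ p, ?_, fun {X} x hx ↦ ?_, fun {X} u w β hβ ↦ ?_⟩
  · have := (fixed_s (𝟙 P)).1
    rwa [Strict.id_comp, ← Strict.assoc, ← Strict.assoc] at this
  · obtain ⟨k, rfl, hk⟩ := hl.exists_lift x (eqToIso hx)
    have hke : k ≫ r ≫ s = k := fixed_of k (by rw [← Strict.assoc, hx, Strict.assoc])
      (hk.trans (eqToHom_heq hx (Strict.assoc _ _ _)))
    refine ⟨k ≫ r, ?_, fun u hu ↦ ?_⟩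
    · change (k ≫ r) ≫ s ≫ p = k ≫ p
      rw [← Strict.assoc (k ≫ r), Strict.assoc k, hke]
    · have : u ≫ s = k := by
        have h₁ : (u ≫ s) ≫ p = k ≫ p := by rw [Strict.assoc, hu]
        refine hl.hom_ext h₁ ((fixed_s u).2.trans (HEq.trans ?_
          (hk.trans (eqToHom_heq hx rfl)).symm))
        exact id_heq_id (by rw [← Strict.assoc, h₁])
      rw [← this, Strict.assoc, hsr', Strict.comp_id]
  · have e₁ : (u ≫ s) ≫ p = u ≫ s ≫ p := Strict.assoc _ _ _
    have e₂ : (w ≫ s) ≫ p = w ≫ s ≫ p := Strict.assoc _ _ _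
    have hβ' : HEq (eqToHom e₁ ≫ β ≫ eqToHom e₂.symm) β := eqToHom_conj_heq _ _ _
    have f₁ : ((u ≫ s) ≫ p) ≫ f = ((u ≫ s) ≫ p) ≫ g := by
      rw [Strict.assoc _ p f, (fixed_s u).1, ← Strict.assoc]
    have f₂ : ((w ≫ s) ≫ p) ≫ f = ((w ≫ s) ≫ p) ≫ g := by
      rw [Strict.assoc _ p f, (fixed_s w).1, ← Strict.assoc]
    obtain ⟨γ, hγ, hγ'⟩ := hl.two_dim (u ≫ s) (w ≫ s) (eqToHom e₁ ≫ β ≫ eqToHom e₂.symm) (by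
      have hr (u : X ⟶ P) : HEq (restrictCell l.hom (u ≫ s)) (𝟙 (((u ≫ s) ≫ p) ≫ f)) :=
        (restrictCell_heq _ _).trans ((fixed_s u).2.trans (id_heq_id (Strict.assoc _ _ _).symm))
      set β' := eqToHom e₁ ≫ β ≫ eqToHom e₂.symm
      have h₁ : HEq (restrictCell l.hom (u ≫ s) ≫ β' ▷ g) (𝟙 _ ≫ β' ▷ g) :=
        comp_heq_comp f₁ rfl rfl ((hr u).trans (id_heq_id f₁)) HEq.rfl
      have h₂ : HEq (β' ▷ f ≫ restrictCell l.hom (w ≫ s)) (β' ▷ f ≫ 𝟙 _) :=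
        comp_heq_comp rfl rfl f₂.symm HEq.rfl (hr w)
      rw [Category.id_comp] at h₁
      rw [Category.comp_id] at h₂
      refine eq_of_heq (h₁.trans (HEq.trans ?_ h₂.symm))
      exact (whiskerRight_heq e₁ e₂ hβ' g).trans
        (hβ.symm.trans (whiskerRight_heq e₁ e₂ hβ' f).symm))
    obtain ⟨δ, hδ, hδ'⟩ := existsUnique_of_splitting hsr' t het u w γ
    refine ⟨δ, eq_of_heq ?_, fun δ₂ hδ₂ ↦ hδ' δ₂ (hγ' _ (eq_of_heq ?_))⟩
    · refine (whiskerRight_comp_heq _ _ _).trans ?_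
      rw [hδ, hγ]
      exact hβ'
    · refine (whiskerRight_comp_heq _ _ _).symm.trans ?_
      rw [hδ₂]
      exact hβ'.symm

end Splittings

/-! ### Pullbacks and limits of towers of normal isofibrations -/

section Cleavages

open Bicategory

variable {K : Type u} [Bicategory.{v, v} K] [Bicategory.Strict K]

variable {A B : K} {f : A ⟶ B} {c : Cleavage f}

lemma IsoLift.iso_hom_whiskerRight_heq {X : K} {g : X ⟶ A} {h : X ⟶ B} {α : g ≫ f ≅ h}
    (l : IsoLift f g h α) : HEq (l.iso.hom ▷ f) α.hom := by
  obtain ⟨o, i, rfl, hi⟩ := l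
  exact heq_of_eq (by simpa using hi)

lemma Cleavage.IsNormal.lift_eq (hc : c.IsNormal) {X : K} {g : X ⟶ A} {h : X ⟶ B}
    (α : g ≫ f ≅ h) (hg : h = g ≫ f) (hα : HEq α.hom (𝟙 h)) :
    (c.lift g h α).obj = g ∧ HEq (c.lift g h α).iso.hom (𝟙 g) := by
  subst hg
  obtain rfl : α = Iso.refl _ := Iso.ext (eq_of_heq hα)
  rw [hc]
  exact ⟨rfl, HEq.rfl⟩

/-- Since the chosen liftings are natural, the restriction of a chosen lifting is an identity as
soon as the restriction of the lifted 2-cell is. -/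
lemma Cleavage.IsNormal.restrict_lift_eq (hc : c.IsNormal) {X Y : K} (k : Y ⟶ X) {g : X ⟶ A}
    {h : X ⟶ B} (α : g ≫ f ≅ h) (hk : k ≫ h = (k ≫ g) ≫ f) (hα : HEq (k ◁ α.hom) (𝟙 (k ≫ h))) :
    k ≫ (c.lift g h α).obj = k ≫ g ∧ HEq (k ◁ (c.lift g h α).iso.hom) (𝟙 (k ≫ g)) := by
  have := hc.lift_eq (restrictIso k α) hk (by
    refine HEq.trans ?_ hα
    simp [restrictIso, Bicategory.Strict.associator_eqToIso])
  rwa [c.natural] at this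

end Cleavages

section Pullbacks

open Bicategory Limits Enriched

variable {K : Type u} [Bicategory.{v, v} K] [Bicategory.Strict K]

lemma HasFlexibleLimits.exists_binaryProduct (h : HasFlexibleLimits K) (A B : K) :
    ∃ (P : K) (fst : P ⟶ A) (snd : P ⟶ B),
      (∀ {X : K} (f : X ⟶ A) (g : X ⟶ B), ∃! u : X ⟶ P, u ≫ fst = f ∧ u ≫ snd = g) ∧
      ∀ {X : K} (u w : X ⟶ P) (α : u ≫ fst ⟶ w ≫ fst) (β : u ≫ snd ⟶ w ≫ snd),
        ∃! γ : u ⟶ w, γ ▷ fst = α ∧ γ ▷ snd = β := by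
  obtain ⟨P, π, hP⟩ := h.products (fun j : ULift.{v} Bool ↦ bif j.down then B else A)
  refine ⟨P, π ⟨false⟩, π ⟨true⟩, fun {X} f g ↦ ?_, fun {X} u w α β ↦ ?_⟩
  · obtain ⟨u, hu, hu'⟩ := hP.one_dim (X := X) (by rintro ⟨_ | _⟩; exacts [f, g])
    exact ⟨u, ⟨hu ⟨false⟩, hu ⟨true⟩⟩, fun w hw ↦ hu' w (by rintro ⟨_ | _⟩; exacts [hw.1, hw.2])⟩
  · obtain ⟨γ, hγ, hγ'⟩ := hP.two_dim u w (by rintro ⟨_ | _⟩; exacts [α, β])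
    exact ⟨γ, ⟨hγ ⟨false⟩, hγ ⟨true⟩⟩, fun δ hδ ↦ hγ' δ (by rintro ⟨_ | _⟩; exacts [hδ.1, hδ.2])⟩

/-- 2-categorical pullbacks along normal isofibrations exist: the iso-comma object of `f` and `g`
can be strictified by means of the cleavage of `f`. -/
lemma HasFlexibleLimits.exists_twoPullback (h : HasFlexibleLimits K) {A B D : K} {f : A ⟶ B}
    (hf : IsNormalIsofibration f) (g : D ⟶ B) :
    ∃ (P : K) (a : P ⟶ A) (d : P ⟶ D), a ≫ f = d ≫ g ∧
      (∀ {X : K} (x : X ⟶ A) (y : X ⟶ D), x ≫ f = y ≫ g → ∃! u : X ⟶ P, u ≫ a = x ∧ u ≫ d = y) ∧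
      ∀ {X : K} (u w : X ⟶ P) (α : u ≫ a ⟶ w ≫ a) (β : u ≫ d ⟶ w ≫ d), HEq (α ▷ f) (β ▷ g) →
        ∃! γ : u ⟶ w, γ ▷ a = α ∧ γ ▷ d = β := by
  obtain ⟨-, c, hc⟩ := hf
  obtain ⟨Q, fst, snd, hQ, hQ'⟩ := h.exists_binaryProduct A D
  obtain ⟨M, p, l, hl⟩ := h.exists_isoInserter (fst ≫ f) (snd ≫ g)
  let l' : (p ≫ fst) ≫ f ≅ p ≫ snd ≫ g := eqToIso (Strict.assoc _ _ _) ≪≫ l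
  have hl' : HEq l'.hom l.hom := by simp [l']
  obtain ⟨p', ⟨hp₁, hp₂⟩, -⟩ := hQ (c.lift _ _ l').obj (p ≫ snd)
  obtain ⟨θ, ⟨hθ₁, hθ₂⟩, -⟩ := hQ' p p'
    ((c.lift _ _ l').iso.hom ≫ eqToHom hp₁.symm) (eqToHom hp₂.symm)
  have hθ₁' : HEq (θ ▷ fst) (c.lift _ _ l').iso.hom := by rw [hθ₁]; simp
  have hp : p' ≫ fst ≫ f = p ≫ snd ≫ g := by
    rw [← Strict.assoc, hp₁, (c.lift _ _ l').obj_comp]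
  have hp' : p' ≫ snd ≫ g = p ≫ snd ≫ g := by rw [← Strict.assoc, hp₂, Strict.assoc]
  have eqToHom_heq {X Y : K} {a b c : X ⟶ Y} (hab : a = b) (hac : a = c) :
      HEq (eqToHom hab) (𝟙 c) := by
    subst hab hac
    rfl
  obtain ⟨P, q, hq⟩ := h.exists_twoEqualizer hl p' θ (hp.trans hp'.symm) (by
    have h₁ : HEq (θ ▷ (snd ≫ g)) (𝟙 (p ≫ snd ≫ g)) := by
      refine (whiskerRight_comp_heq _ _ _).trans ?_
      rw [hθ₂, eqToHom_whiskerRight]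
      exact eqToHom_heq _ (Strict.assoc _ _ _)
    have h₂ : HEq (θ ▷ (fst ≫ f)) l.hom :=
      (whiskerRight_comp_heq _ _ _).trans ((whiskerRight_heq rfl hp₁ hθ₁' f).trans
        ((c.lift _ _ l').iso_hom_whiskerRight_heq.trans hl'))
    have h₃ : HEq (l.hom ≫ θ ▷ (snd ≫ g)) (l.hom ≫ 𝟙 _) :=
      comp_heq_comp rfl rfl hp' HEq.rfl h₁
    rw [Category.comp_id] at h₃
    exact h₃.trans h₂.symm) (fun {X} k hk hkl ↦ by
    have h₁ : HEq (k ◁ l'.hom) (𝟙 (k ≫ p ≫ snd ≫ g)) :=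
      (whiskerLeft_heq (Strict.assoc _ _ _) rfl hl' k).trans (hkl.trans (id_heq_id hk))
    obtain ⟨h₂, h₃⟩ := hc.restrict_lift_eq k l' (by rw [← hk, Strict.assoc, Strict.assoc]) h₁
    have e₁ : (k ≫ p') ≫ fst = (k ≫ p) ≫ fst := by rw [Strict.assoc, hp₁, h₂, Strict.assoc]
    have e₂ : (k ≫ p') ≫ snd = (k ≫ p) ≫ snd := by rw [Strict.assoc, hp₂, Strict.assoc]
    have e : k ≫ p' = k ≫ p := (hQ _ _).unique ⟨e₁, e₂⟩ ⟨rfl, rfl⟩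
    refine ⟨e, ?_⟩
    have : k ◁ θ = eqToHom e.symm := by
      refine (hQ' _ _ _ _).unique ⟨rfl, rfl⟩ ⟨eq_of_heq ?_, eq_of_heq ?_⟩
      · rw [eqToHom_whiskerRight]
        refine (eqToHom_heq _ rfl).trans (HEq.symm ?_)
        refine (whisker_assoc_heq _ _ _).trans ((whiskerLeft_heq rfl hp₁ hθ₁' k).trans ?_)
        exact h₃.trans (id_heq_id (Strict.assoc _ _ _).symm)
      · rw [eqToHom_whiskerRight]
        refine (eqToHom_heq _ rfl).trans (HEq.symm ?_)
        refine (whisker_assoc_heq _ _ _).trans ?_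
        rw [hθ₂, whiskerLeft_eqToHom]
        exact eqToHom_heq _ (Strict.assoc _ _ _).symm
    rw [this]
    exact eqToHom_heq _ rfl)
  refine ⟨P, q ≫ fst, q ≫ snd, by rw [Strict.assoc, hq.w, Strict.assoc], fun {X} x y hxy ↦ ?_,
    fun {X} u w α β hαβ ↦ ?_⟩
  · obtain ⟨z, ⟨rfl, rfl⟩, -⟩ := hQ x y
    obtain ⟨u, rfl, hu'⟩ := hq.one_dim z (by rwa [← Strict.assoc, ← Strict.assoc])
    refine ⟨u, ⟨(Strict.assoc _ _ _).symm, (Strict.assoc _ _ _).symm⟩, fun w hw ↦ hu' w ?_⟩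
    exact (hQ _ _).unique ⟨(Strict.assoc _ _ _).trans hw.1, (Strict.assoc _ _ _).trans hw.2⟩
      ⟨rfl, rfl⟩
  · have a₁ {D : K} (u : X ⟶ P) (r : Q ⟶ D) : (u ≫ q) ≫ r = u ≫ q ≫ r := Strict.assoc _ _ _
    obtain ⟨γ, ⟨hγ₁, hγ₂⟩, -⟩ := hQ' (u ≫ q) (w ≫ q)
      (eqToHom (a₁ u _) ≫ α ≫ eqToHom (a₁ w _).symm) (eqToHom (a₁ u _) ≫ β ≫ eqToHom (a₁ w _).symm)
    have hγ₁' : HEq (γ ▷ fst) α := by rw [hγ₁]; exact eqToHom_conj_heq _ _ _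
    have hγ₂' : HEq (γ ▷ snd) β := by rw [hγ₂]; exact eqToHom_conj_heq _ _ _
    obtain ⟨δ, rfl, hδ⟩ := hq.two_dim u w γ
      ((whiskerRight_comp_heq _ _ _).trans ((whiskerRight_heq (a₁ _ _) (a₁ _ _) hγ₁' f).trans
        (hαβ.trans ((whiskerRight_heq (a₁ _ _) (a₁ _ _) hγ₂' g).symm.trans
          (whiskerRight_comp_heq _ _ _).symm))))
    refine ⟨δ, ⟨eq_of_heq ((whiskerRight_comp_heq _ _ _).trans hγ₁'),
      eq_of_heq ((whiskerRight_comp_heq _ _ _).trans hγ₂')⟩, fun ε' hε ↦ hδ ε' ?_⟩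
    refine (hQ' _ _ _ _).unique ⟨eq_of_heq ?_, eq_of_heq ?_⟩ ⟨rfl, rfl⟩
    · refine (whiskerRight_comp_heq _ _ _).symm.trans ?_
      rw [hε.1]
      exact hγ₁'.symm
    · refine (whiskerRight_comp_heq _ _ _).symm.trans ?_
      rw [hε.2]
      exact hγ₂'.symm

lemma HasFlexibleLimits.hasConicalPullback (h : HasFlexibleLimits K) {A B D : K} {f : A ⟶ B}
    (hf : IsNormalIsofibration f) (g : D ⟶ B) : HasConicalPullback SSet.{v} f g := by
  obtain ⟨P, a, d, w, h₁, h₂⟩ := h.exists_twoPullback hf g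
  choose l hl hl' using @h₁
  refine IsTwoLimit.hasConicalLimit (c := PullbackCone.mk a d w) ⟨⟨PullbackCone.IsLimit.mk _
    (fun s ↦ l s.fst s.snd s.condition) (fun s ↦ (hl s.fst s.snd s.condition).1)
    (fun s ↦ (hl s.fst s.snd s.condition).2)
    (fun s m hm hm' ↦ hl' s.fst s.snd s.condition m ⟨hm, hm'⟩)⟩, fun {X} u v β hβ ↦ ?_⟩
  have hf' : HEq (β .left ▷ f) (β .one) := hβ WalkingCospan.Hom.inl
  have hg' : HEq (β .right ▷ g) (β .one) := hβ WalkingCospan.Hom.inr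
  obtain ⟨γ, ⟨hγ₁, hγ₂⟩, hγ⟩ := h₂ u v (β .left) (β .right) (hf'.trans hg'.symm)
  refine ⟨γ, fun j ↦ ?_, fun δ hδ ↦ hγ δ ⟨hδ .left, hδ .right⟩⟩
  obtain _ | _ | _ := j
  · refine eq_of_heq (HEq.trans ?_ hf')
    refine (IsTwoLimit.whiskerRight_w (PullbackCone.mk a d w) γ WalkingCospan.Hom.inl).symm.trans ?_
    rw [← hγ₁]
    rfl
  · exact hγ₁
  · exact hγ₂

end Pullbacks

section Towers

open Bicategory Limits Enriched Opposite

variable {K : Type u} [Bicategory.{v, v} K] [Bicategory.Strict K]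

/-- Limits of towers of normal isofibrations exist: starting from a family of objects `p n` with
isomorphisms `p (n + 1) ≫ f n ≅ p n`, the family is strictified successively by means of the
cleavages. -/
lemma HasFlexibleLimits.hasConicalLimit_tower (h : HasFlexibleLimits K) (F : ℕᵒᵖ ⥤ K)
    (hF : IsTowerOf (fun _ _ f ↦ IsNormalIsofibration f) F) : HasConicalLimit SSet.{v} F := by
  let A (n : ℕ) : K := F.obj (op n)
  let f (n : ℕ) : A (n + 1) ⟶ A n := F.map (homOfLE (Nat.le_succ n)).op
  choose c hc using fun n ↦ (hF n).2
  obtain ⟨Q, π', hQ'⟩ := h.products (fun n : ULift.{v} ℕ ↦ A n.down)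
  let π (n : ℕ) : Q ⟶ A n := π' ⟨n⟩
  have one_dim {X : K} (a : ∀ n, X ⟶ A n) : ∃ u : X ⟶ Q, ∀ n, u ≫ π n = a n := by
    obtain ⟨u, hu, -⟩ := hQ'.one_dim (fun n ↦ a n.down)
    exact ⟨u, fun n ↦ hu ⟨n⟩⟩
  have hom_ext {X : K} {u w : X ⟶ Q} (huw : ∀ n, u ≫ π n = w ≫ π n) : u = w :=
    hQ'.hom_ext fun n ↦ huw n.down
  have two_dim {X : K} (u w : X ⟶ Q) (α : ∀ n, u ≫ π n ⟶ w ≫ π n) :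
      ∃ γ : u ⟶ w, ∀ n, γ ▷ π n = α n := by
    obtain ⟨γ, hγ, -⟩ := hQ'.two_dim u w (fun n ↦ α n.down)
    exact ⟨γ, fun n ↦ hγ ⟨n⟩⟩
  have cell_hext {X : K} {a b a' b' : X ⟶ Q} {γ : a ⟶ b} {γ' : a' ⟶ b'} (ha : a = a')
      (hb : b = b') (hγ : ∀ n, HEq (γ ▷ π n) (γ' ▷ π n)) : HEq γ γ' :=
    hQ'.cell_hext ha hb fun n ↦ hγ n.down
  clear_value π
  -- The limit is the equalizer of `s` and the identity.
  obtain ⟨s, hs⟩ := one_dim (fun n ↦ π (n + 1) ≫ f n)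
  obtain ⟨M, p, l, hl⟩ := h.exists_isoInserter s (𝟙 Q)
  have e₁ (n : ℕ) : (p ≫ π (n + 1)) ≫ f n = (p ≫ s) ≫ π n := by
    rw [Strict.assoc, ← hs, Strict.assoc]
  have e₂ (n : ℕ) : (p ≫ 𝟙 Q) ≫ π n = p ≫ π n := by rw [Strict.comp_id]
  let l' (n : ℕ) : (p ≫ π (n + 1)) ≫ f n ≅ p ≫ π n :=
    eqToIso (e₁ n) ≪≫ whiskerRightIso l (π n) ≪≫ eqToIso (e₂ n)
  have hl' (n : ℕ) : HEq (l' n).hom (l.hom ▷ π n) :=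
    eqToHom_conj_heq (l.hom ▷ π n) (e₁ n) (e₂ n)
  let S (n : ℕ) : Σ a : M ⟶ A n, (p ≫ π n ≅ a) := Nat.rec ⟨p ≫ π 0, Iso.refl _⟩
    (fun n t ↦ ⟨_, ((c n).lift (p ≫ π (n + 1)) t.1 (l' n ≪≫ t.2)).iso⟩) n
  have hS (n : ℕ) : (S (n + 1)).1 ≫ f n = (S n).1 := IsoLift.obj_comp _
  have hSl (n : ℕ) : HEq ((S (n + 1)).2.hom ▷ f n) ((l' n).hom ≫ (S n).2.hom) :=
    IsoLift.iso_hom_whiskerRight_heq ((c n).lift (p ≫ π (n + 1)) _ (l' n ≪≫ (S n).2))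
  obtain ⟨p', hp'⟩ := one_dim (fun n ↦ (S n).1)
  obtain ⟨θ, hθ⟩ := two_dim p p' (fun n ↦ (S n).2.hom ≫ eqToHom (hp' n).symm)
  have hθ' (n : ℕ) : HEq (θ ▷ π n) (S n).2.hom := by rw [hθ]; simp
  have hps : p' ≫ s = p' ≫ 𝟙 Q := hom_ext fun n ↦ by
    rw [Strict.assoc, hs, ← Strict.assoc, hp', hS, Strict.comp_id, hp']
  have whisker_s {X : K} {a b : X ⟶ Q} (γ : a ⟶ b) (n : ℕ) :
      HEq (γ ▷ s ▷ π n) (γ ▷ π (n + 1) ▷ f n) := by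
    refine (whiskerRight_comp_heq _ _ _).symm.trans ?_
    rw [hs]
    exact whiskerRight_comp_heq _ _ _
  have hnormal {X : K} (k : X ⟶ M) (hk : k ≫ p ≫ s = k ≫ p ≫ 𝟙 Q)
      (hkl : HEq (k ◁ l.hom) (𝟙 (k ≫ p ≫ s))) (n : ℕ) :
      k ≫ (S n).1 = k ≫ p ≫ π n ∧ HEq (k ◁ (S n).2.hom) (𝟙 (k ≫ p ≫ π n)) := by
    induction n with
    | zero => exact ⟨rfl, heq_of_eq (whiskerLeft_id _ _)⟩
    | succ n ih =>
      have e₃ : k ≫ (p ≫ π (n + 1)) ≫ f n = (k ≫ p ≫ s) ≫ π n := by rw [e₁, ← Strict.assoc]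
      have e₄ : (k ≫ p ≫ 𝟙 Q) ≫ π n = k ≫ p ≫ π n := by rw [Strict.comp_id, Strict.assoc]
      refine Cleavage.IsNormal.restrict_lift_eq (hc n) k (l' n ≪≫ (S n).2) ?_ ?_
      · change k ≫ (S n).1 = _
        rw [ih.1, Strict.assoc k, e₃, hk, e₄]
      · change HEq (k ◁ ((l' n).hom ≫ (S n).2.hom)) (𝟙 (k ≫ (S n).1))
        have h₁ : HEq (k ◁ (l' n).hom) (𝟙 (k ≫ p ≫ π n)) := by
          refine (whiskerLeft_heq (e₁ n) (e₂ n).symm (hl' n) k).trans ?_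
          refine (whisker_assoc_heq _ _ _).symm.trans ?_
          refine (whiskerRight_heq rfl hk.symm hkl (π n)).trans ?_
          rw [id_whiskerRight]
          exact id_heq_id (by rw [hk, e₄])
        have h₂ := comp_heq_comp (e₃.trans (by rw [hk, e₄])) rfl ih.1 h₁ ih.2
        rw [Category.comp_id] at h₂
        rw [whiskerLeft_comp]
        exact h₂.trans (id_heq_id ih.1.symm)
  obtain ⟨P, q, hq⟩ := h.exists_twoEqualizer hl p' θ hps (by
    refine cell_hext rfl hps.symm fun n ↦ HEq.trans ?_ ((hSl n).symm.trans ?_)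
    · rw [comp_whiskerRight]
      exact comp_heq_comp (e₁ n).symm (e₂ n) (by rw [Strict.comp_id, hp']) (hl' n).symm
        ((whiskerRight_heq (Strict.comp_id _) (Strict.comp_id _) (whiskerRight_id_heq θ) _).trans
          (hθ' n))
    · exact ((whisker_s θ n).trans (whiskerRight_heq rfl (hp' _) (hθ' (n + 1)) (f n))).symm)
    (fun {X} k hk hkl ↦ by
      have e : k ≫ p' = k ≫ p := hom_ext fun n ↦ by
        rw [Strict.assoc, hp', (hnormal k hk hkl n).1, Strict.assoc]
      refine ⟨e, cell_hext rfl e fun n ↦ ?_⟩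
      refine (whisker_assoc_heq _ _ _).trans ((whiskerLeft_heq rfl (hp' n) (hθ' n) k).trans ?_)
      rw [id_whiskerRight]
      exact (hnormal k hk hkl n).2.trans (id_heq_id (Strict.assoc _ _ _).symm))
  have hqf (n : ℕ) : (q ≫ π (n + 1)) ≫ f n = q ≫ π n := by
    rw [Strict.assoc, ← hs, ← Strict.assoc, hq.w, Strict.comp_id]
  let cone : Cone F := ⟨P, NatTrans.ofOpSequence (F := (Functor.const _).obj P)
    (fun n ↦ q ≫ π n) (fun n ↦ (Category.id_comp _).trans (hqf n).symm)⟩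
  have hx (t : Cone F) : ∃ u : t.pt ⟶ P, ∀ n : ℕ, u ≫ q ≫ π n = t.π.app (op n) := by
    obtain ⟨x, hx⟩ := one_dim (fun n ↦ t.π.app (op n))
    obtain ⟨u, hu, -⟩ := hq.one_dim x (hom_ext fun n ↦ by
      rw [Strict.assoc, hs, ← Strict.assoc, hx, Strict.comp_id, hx]
      exact t.w _)
    exact ⟨u, fun n ↦ by rw [← Strict.assoc, hu, hx]⟩
  have huniq {X : K} {u w : X ⟶ P} (huw : ∀ n, u ≫ q ≫ π n = w ≫ q ≫ π n) : u = w := by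
    have : u ≫ q = w ≫ q := hom_ext fun n ↦ by rw [Strict.assoc, huw, Strict.assoc]
    exact (hq.one_dim (w ≫ q) (by rw [Strict.assoc, hq.w, Strict.assoc])).unique this rfl
  choose lift hlift using hx
  refine IsTwoLimit.hasConicalLimit (c := cone) ⟨⟨⟨lift, fun t j ↦ hlift t j.unop,
    fun t m hm ↦ huniq fun n ↦ (hm (op n)).trans (hlift t n).symm⟩⟩, fun {X} u w β hβ ↦ ?_⟩
  have a₁ (u : X ⟶ P) (n : ℕ) : (u ≫ q) ≫ π n = u ≫ q ≫ π n := Strict.assoc _ _ _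
  obtain ⟨γ, hγ⟩ := two_dim (u ≫ q) (w ≫ q) (fun n ↦
    eqToHom (a₁ u n) ≫ β (op n) ≫ eqToHom (a₁ w n).symm)
  have hγ' (n : ℕ) : HEq (γ ▷ π n) (β (op n)) := by
    rw [hγ]
    exact eqToHom_conj_heq _ _ _
  obtain ⟨δ, hδ, hδ'⟩ := hq.two_dim u w γ (by
    have e₃ (u : X ⟶ P) : (u ≫ q) ≫ s = (u ≫ q) ≫ 𝟙 Q := by rw [Strict.assoc, hq.w, Strict.assoc]
    refine cell_hext (e₃ u) (e₃ w) fun n ↦ ?_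
    refine (whisker_s γ n).trans ((whiskerRight_heq (a₁ _ _) (a₁ _ _) (hγ' (n + 1)) _).trans ?_)
    refine (hβ (homOfLE (Nat.le_succ n)).op).trans ((hγ' n).symm.trans ?_)
    exact whiskerRight_heq (Strict.comp_id _).symm (Strict.comp_id _).symm
      (whiskerRight_id_heq γ).symm _)
  refine ⟨δ, fun j ↦ eq_of_heq ((whiskerRight_comp_heq _ _ _).trans ?_), fun δ₂ hδ₂ ↦ hδ' δ₂ ?_⟩
  · rw [hδ]
    exact hγ' j.unop
  · refine eq_of_heq (cell_hext rfl rfl fun n ↦ ?_)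
    refine (whiskerRight_comp_heq _ _ _).symm.trans ?_
    exact (heq_of_eq (hδ₂ (op n))).trans (hγ' n).symm

end Towers

/-! ### Powers by a simplicial set and functors on its homotopy category -/

section HomotopyCat

open MonoidalCategory Simplicial Opposite SSet SSet.Truncated SSet.Truncated.HomotopyCategory

/-- The homotopy category of a simplicial set `S`: the value at `S` of the left adjoint of the
nerve functor. -/
abbrev HoCat (S : SSet.{v}) : Type v := ((SSet.truncation 2).obj S).HomotopyCategory

/-- The functor out of the homotopy category of `S` corresponding to a map from `S` to a nerve. -/
abbrev toHo {S : SSet.{v}} {C : Type v} [SmallCategory C] (φ : S ⟶ nerve C) : HoCat S ⥤ C :=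
  descOfTruncation ((SSet.truncation 2).map φ)

/-- Since nerves are 2-coskeletal, maps into a nerve only depend on the 2-truncation, on which the
homotopy category is defined. -/
lemma toHo_bijective (S : SSet.{v}) (C : Type v) [SmallCategory C] :
    Function.Bijective (toHo : (S ⟶ nerve C) → (HoCat S ⥤ C)) := by
  have h1 : Function.Bijective (fun φ : S ⟶ nerve C ↦ (SSet.truncation 2).map φ) := by
    have : IsIso ((SSet.coskAdj 2).unit.app (nerve C)) :=
      (SimplicialObject.isCoskeletal_iff_isIso (X := nerve C) 2).1 inferInstance
    have h : Function.Bijective (fun φ : S ⟶ nerve C ↦ φ ≫ (SSet.coskAdj 2).unit.app (nerve C)) :=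
      (asIso ((SSet.coskAdj 2).unit.app (nerve C))).homToEquiv.bijective
    have e := ((SSet.coskAdj 2).homEquiv S ((SSet.truncation 2).obj (nerve C))).bijective
    refine (Function.Bijective.of_comp_iff' e _).1 ?_
    have : (SSet.coskAdj 2).homEquiv S ((SSet.truncation 2).obj (nerve C)) ∘
        (fun φ : S ⟶ nerve C ↦ (SSet.truncation 2).map φ) =
        fun φ ↦ φ ≫ (SSet.coskAdj 2).unit.app (nerve C) := by
      funext φ
      simp [Adjunction.homEquiv_unit]
    rw [this]
    exact h
  exact functorEquiv.symm.bijective.comp h1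

lemma toHo_map_homMk_heq {S : SSet.{v}} {C : Type v} [SmallCategory C] (φ : S ⟶ nerve C)
    {x y : ((SSet.truncation 2).obj S).obj (op ⟨⦋0⦌, by simp⟩)} (e : SSet.Truncated.Edge x y) :
    (toHo φ).map (homMk e) ≍
      (ComposableArrows.hom (φ.app (op ⦋1⦌) e.edge : ComposableArrows C 1)) :=
  (heq_of_eq (descOfTruncation_map_homMk _ e)).trans (eqToHom_conj_heq _ _ _)

lemma toHo_comp {S T : SSet.{v}} {C : Type v} [SmallCategory C] (i : S ⟶ T) (φ : T ⟶ nerve C) :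
    toHo (i ≫ φ) = mapHomotopyCategory ((SSet.truncation 2).map i) ⋙ toHo φ := by
  unfold toHo
  rw [Functor.map_comp]
  exact descOfTruncation_comp _ _

lemma toHo_comp_nerveMap {S : SSet.{v}} {C D : Type v} [SmallCategory C] [SmallCategory D]
    (φ : S ⟶ nerve C) (G : C ⥤ D) : toHo (φ ≫ nerveMap G) = toHo φ ⋙ G := by
  refine functor_ext (fun x ↦ rfl) (fun x y e ↦ ?_)
  apply eq_of_heq
  refine (toHo_map_homMk_heq _ e).trans (HEq.trans ?_ (eqToHom_conj_heq _ _ _).symm)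
  exact map_heq G (congrArg (fun x : ComposableArrows C 0 ↦ x.obj 0)
      (show _ = ((SSet.truncation 2).map φ).app _ x from (e.map _).src_eq))
    (congrArg (fun x : ComposableArrows C 0 ↦ x.obj 0)
      (e.map ((SSet.truncation 2).map φ)).tgt_eq)
    (toHo_map_homMk_heq φ e).symm

lemma precomp_bijective {C D E : Type*} [Category* C] [Category* D] [Category* E] (I : C ⥤ D)
    (J : D ⥤ C) (h : I ⋙ J = 𝟭 C) (h' : J ⋙ I = 𝟭 D) :
    Function.Bijective (fun G : D ⥤ E ↦ I ⋙ G) := by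
  refine Function.bijective_iff_has_inverse.2 ⟨fun G ↦ J ⋙ G, fun G ↦ ?_, fun G ↦ ?_⟩
  · change (J ⋙ I) ⋙ G = G
    rw [h']
    rfl
  · change (I ⋙ J) ⋙ G = G
    rw [h]
    rfl

/-- The homotopy category of a product of simplicial sets is the product of the homotopy
categories, so functors out of it can be curried. -/
lemma uncurry_bijective (S T : SSet.{v}) (C : Type v) [SmallCategory C] :
    Function.Bijective (fun G : HoCat T ⥤ HoCat S ⥤ C ↦
      (BinaryProduct.functor ((SSet.truncation 2).obj S) ((SSet.truncation 2).obj T) ⋙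
        CategoryTheory.Prod.swap _ _ ⋙ Functor.uncurry.obj G : HoCat (S ⊗ T) ⥤ C)) := by
  have h1 : Function.Bijective (fun G : HoCat T ⥤ HoCat S ⥤ C ↦ Functor.uncurry.obj G) :=
    Function.bijective_iff_has_inverse.2 ⟨fun G ↦ Functor.curry.obj G,
      fun G ↦ Functor.curry_obj_uncurry_obj G, fun G ↦ Functor.uncurry_obj_curry_obj G⟩
  have h2 := precomp_bijective (E := C) (CategoryTheory.Prod.swap (HoCat S) (HoCat T))
    (CategoryTheory.Prod.swap _ _) rfl rfl
  have h3 := precomp_bijective (E := C) _ _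
    (BinaryProduct.functor_comp_inverse ((SSet.truncation 2).obj S) ((SSet.truncation 2).obj T))
    (BinaryProduct.inverse_comp_functor _ _)
  exact h3.comp (h2.comp h1)

end HomotopyCat

section Power

open MonoidalCategory Simplicial Opposite SSet SSet.Truncated SSet.Truncated.HomotopyCategory
  Bicategory SimplicialCategory

variable {K : Type u} [Bicategory.{v, v} K] [Bicategory.Strict K]

/-- A functor `F : D ⥤ (P ⟶ A)`, seen as a family of 1-cells and 2-cells from `P` to `A`, induces by
restriction a functor from `B ⟶ P` to functors `D ⥤ (B ⟶ A)`. If it is an isomorphism for all `B`,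
then `P` is the power of `A` by the category `D`. -/
def powerFunctor {D : Type*} [Category* D] {A P : K} (F : D ⥤ (P ⟶ A)) (B : K) :
    (B ⟶ P) ⥤ D ⥤ (B ⟶ A) where
  obj u := F ⋙ precomp A u
  map η := { app d := η ▷ F.obj d
             naturality _ _ f := Bicategory.whisker_exchange _ _ }

lemma hcomp_heq {A B C : K} {f f' g g' : A ⟶ B} {h h' k k' : B ⟶ C} {η : f ⟶ g} {η' : f' ⟶ g'}
    {θ : h ⟶ k} {θ' : h' ⟶ k'} (hf : f = f') (hg : g = g') (hh : h = h') (hk : k = k')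
    (hη : η ≍ η') (hθ : θ ≍ θ') : η ▷ h ≫ g ◁ θ ≍ η' ▷ h' ≫ g' ◁ θ' := by
  subst hf hg hh hk
  rw [eq_of_heq hη, eq_of_heq hθ]

/-- The map underlying `powerComparison κ`, transposed to `S ⊗ T ⟶ nerve (B ⟶ A)`, corresponds to
composition with `powerFunctor`. -/
lemma toHo_uncurry_powerComparison {A P B : K} {S T : SSet.{v}} (κ : S ⟶ sHom P A)
    (t : T ⟶ sHom B P) :
    toHo (C := (B ⟶ A)) (S ◁ t ≫ (β_ S (sHom B P)).hom ≫ sHom B P ◁ κ ≫ sHomComp B P A) =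
      BinaryProduct.functor ((SSet.truncation 2).obj S) ((SSet.truncation 2).obj T) ⋙
        CategoryTheory.Prod.swap _ _ ⋙ Functor.uncurry.obj
        (toHo (C := (B ⟶ P)) t ⋙ powerFunctor (toHo (C := (P ⟶ A)) κ) B) := by
  refine functor_ext (fun x ↦ rfl) (fun x y e ↦ ?_)
  obtain ⟨s, τ⟩ := x
  obtain ⟨s', τ'⟩ := y
  obtain ⟨e1, e2, rfl⟩ := Edge.tensor_surjective (X := (SSet.truncation 2).obj S)
    (Y := (SSet.truncation 2).obj T) e
  apply eq_of_heq
  refine (toHo_map_homMk_heq (C := (B ⟶ A)) _ _).trans (HEq.trans ?_ (eqToHom_conj_heq _ _ _).symm)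
  change ComposableArrows.hom (t.app (op ⦋1⦌) e2.edge : ComposableArrows (B ⟶ P) 1) ▷ _ ≫
    _ ◁ ComposableArrows.hom (κ.app (op ⦋1⦌) e1.edge : ComposableArrows (P ⟶ A) 1) ≍
    ((toHo (C := (B ⟶ P)) t).map (homMk e2)) ▷ _ ≫ _ ◁ (toHo (C := (P ⟶ A)) κ).map (homMk e1)
  exact hcomp_heq
    (congrArg (fun x : ComposableArrows _ 0 ↦ x.obj 0)
      (show _ = ((SSet.truncation 2).map t).app _ τ from (e2.map _).src_eq))
    (congrArg (fun x : ComposableArrows _ 0 ↦ x.obj 0)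
      (show _ = ((SSet.truncation 2).map t).app _ τ' from (e2.map _).tgt_eq))
    (congrArg (fun x : ComposableArrows _ 0 ↦ x.obj 0)
      (show _ = ((SSet.truncation 2).map κ).app _ s from (e1.map _).src_eq))
    (congrArg (fun x : ComposableArrows _ 0 ↦ x.obj 0)
      (show _ = ((SSet.truncation 2).map κ).app _ s' from (e1.map _).tgt_eq))
    (toHo_map_homMk_heq (C := (B ⟶ P)) t e2).symm (toHo_map_homMk_heq (C := (P ⟶ A)) κ e1).symm

/-- A functor is an isomorphism of categories. -/
def IsIsoFunctor {C D : Type*} [Category* C] [Category* D] (F : C ⥤ D) : Prop :=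
  ∃ G : D ⥤ C, F ⋙ G = 𝟭 C ∧ G ⋙ F = 𝟭 D

/-- The counit `HoCat (nerve D) ⥤ D` is invertible: functors out of `D` are maps of nerves. -/
lemma toHo_id_bijective (D E : Type v) [SmallCategory D] [SmallCategory E] :
    Function.Bijective (fun G : D ⥤ E ↦ toHo.{v} (𝟙 (nerve.{v, v} D)) ⋙ G) := by
  have hN : Function.Bijective
      (fun G : D ⥤ E ↦ (nerveMap.{v, v} G : nerve.{v, v} D ⟶ nerve.{v, v} E)) :=
    ⟨fun _ _ h ↦ nerveMap_injective h, exists_nerveMap_eq⟩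
  convert (toHo_bijective (nerve.{v, v} D) E).comp hN using 1
  funext G
  simp only [Function.comp_apply]
  rw [← toHo_comp_nerveMap, Category.id_comp]

/-- A Yoneda lemma for small categories, tested on homotopy categories of simplicial sets. -/
lemma isIsoFunctor_iff {C D : Type v} [SmallCategory C] [SmallCategory D] (F : C ⥤ D) :
    IsIsoFunctor F ↔ ∀ T : SSet.{v}, Function.Bijective (fun G : HoCat T ⥤ C ↦ G ⋙ F) := by
  constructor
  · rintro ⟨F', h, h'⟩ T
    refine Function.bijective_iff_has_inverse.2 ⟨fun G ↦ G ⋙ F', fun G ↦ ?_, fun G ↦ ?_⟩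
    · change G ⋙ (F ⋙ F') = G
      rw [h]
      rfl
    · change G ⋙ (F' ⋙ F) = G
      rw [h']
      rfl
  · intro h
    have h' (E : Type v) [SmallCategory E] : Function.Bijective (fun G : E ⥤ C ↦ G ⋙ F) :=
      (Function.Bijective.of_comp_iff' (toHo_id_bijective E D) _).1
        ((h (nerve.{v, v} E)).comp (toHo_id_bijective E C))
    obtain ⟨G, hG⟩ := (h' D).2 (𝟭 D)
    refine ⟨G, (h' C).1 ?_, hG⟩
    change F ⋙ (G ⋙ F) = F
    rw [show G ⋙ F = 𝟭 D from hG]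
    rfl

/-- The simplicial powers of `A` by `S` are the 2-categorical powers of `A` by the homotopy category
of `S`. -/
lemma isPower_iff {A P : K} {S : SSet.{v}} (κ : S ⟶ sHom P A) :
    IsPower κ ↔ ∀ B : K, IsIsoFunctor (powerFunctor (toHo (C := (P ⟶ A)) κ) B) := by
  refine forall_congr' fun B ↦ ?_
  rw [isIsoFunctor_iff, isIso_iff_yoneda_map_bijective]
  refine forall_congr' fun T ↦ ?_
  have h1 := toHo_bijective T (B ⟶ P)
  have h2 := toHo_bijective (S ⊗ T) (B ⟶ A)
  have h3 := uncurry_bijective S T (B ⟶ A)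
  have h4 : Function.Bijective
      (fun f : T ⟶ (ihom S).obj (nerve (B ⟶ A)) ↦ MonoidalClosed.uncurry f) :=
    ((ihom.adjunction S).homEquiv T _).symm.bijective
  rw [← Function.Bijective.of_comp_iff' (h2.comp h4), ← Function.Bijective.of_comp_iff' h3,
    ← Function.Bijective.of_comp_iff _ h1]
  refine iff_of_eq (congrArg _ (funext fun t ↦ ?_))
  simp only [Function.comp_apply]
  refine Eq.trans (congrArg (toHo (C := (B ⟶ A))) ?_) (toHo_uncurry_powerComparison κ t)
  rw [MonoidalClosed.uncurry_natural_left]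
  simp [powerComparison]

end Power

/-! ### Existence of powers -/

section Power

open Bicategory SimplicialCategory

lemma IsIsoFunctor.of_bijective {C D : Type*} [Category* C] [Category* D] (F : C ⥤ D) [F.Full]
    [F.Faithful] (hF : Function.Bijective F.obj) : IsIsoFunctor F := by
  let e := Equiv.ofBijective F.obj hF
  have he (d : D) : F.obj (e.symm d) = d := e.apply_symm_apply d
  have he' (c : C) : e.symm (F.obj c) = c := e.symm_apply_apply c
  let G : D ⥤ C :=
    { obj d := e.symm d
      map f := F.preimage (eqToHom (he _) ≫ f ≫ eqToHom (he _).symm)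
      map_id d := F.map_injective (by simp)
      map_comp f g := F.map_injective (by simp) }
  refine ⟨G, ?_, ?_⟩
  · refine CategoryTheory.Functor.ext he' fun c d f ↦ F.map_injective ?_
    simp [G, eqToHom_map]
  · refine CategoryTheory.Functor.ext he fun c d f ↦ ?_
    simp [G]

variable {K : Type u} [Bicategory.{v, v} K] [Bicategory.Strict K]

/-- 2-categorical powers: `P` is the universal action of `D` on the product of copies of `A` indexed
by the objects of `D`. -/
lemma HasFlexibleLimits.exists_powerFunctor (h : HasFlexibleLimits K) (D : Type v)
    [SmallCategory D] (A : K) :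
    ∃ (P : K) (F : D ⥤ (P ⟶ A)), ∀ B : K, IsIsoFunctor (powerFunctor F B) := by
  obtain ⟨Q, π, hQ⟩ := h.products (fun _ : D ↦ A)
  obtain ⟨P, p, l, hl⟩ := h.exists_universalAction π
  let F : D ⥤ (P ⟶ A) :=
    { obj d := p ≫ π d
      map φ := l φ
      map_id := hl.map_id
      map_comp := hl.map_comp }
  refine ⟨P, F, fun B ↦ ?_⟩
  have hff {u u' : B ⟶ P} (α : (powerFunctor F B).obj u ⟶ (powerFunctor F B).obj u') :
      ∃ γ : u ⟶ u', (powerFunctor F B).map γ = α := by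
    obtain ⟨α', hα', hn⟩ : ∃ α' : ∀ d, u ≫ p ≫ π d ⟶ u' ≫ p ≫ π d, (∀ d, α.app d = α' d) ∧
        ∀ {c d : D} (φ : c ⟶ d), u ◁ l φ ≫ α' d = α' c ≫ u' ◁ l φ :=
      ⟨fun d ↦ α.app d, fun d ↦ rfl, fun φ ↦ α.naturality φ⟩
    obtain ⟨β, hβ, -⟩ := hQ.two_dim (u ≫ p) (u' ≫ p)
      (fun d ↦ (α_ u p (π d)).hom ≫ α' d ≫ (α_ u' p (π d)).inv)
    obtain ⟨γ, hγ, -⟩ := hl.two_dim u u' β (fun {c d} φ ↦ by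
      simp [hβ, restrictCell, reassoc_of% (hn φ)])
    refine ⟨γ, NatTrans.ext (funext fun d ↦ ?_)⟩
    change γ ▷ (p ≫ π d) = α.app d
    rw [hα', whiskerRight_comp, hγ, hβ]
    simp
  have : (powerFunctor F B).Full := ⟨fun α ↦ hff α⟩
  have : (powerFunctor F B).Faithful := ⟨fun {u u' γ γ'} e ↦ by
    have hd (d : D) : γ ▷ p ▷ π d = γ' ▷ p ▷ π d := by
      have : γ ▷ (p ≫ π d) = γ' ▷ (p ≫ π d) := congrArg (fun α ↦ NatTrans.app α d) e
      simpa using this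
    refine (hl.two_dim u u' (γ' ▷ p) fun {c d} φ ↦ ?_).unique (hQ.cell_ext hd) rfl
    have := whisker_exchange γ' (l φ)
    simp only [whiskerRight_comp, Category.assoc] at this
    simp only [restrictCell, Category.assoc]
    rw [← cancel_epi (α_ u p (π c)).inv, ← cancel_mono (α_ u' p (π d)).hom]
    simpa using this⟩
  refine .of_bijective _ ⟨fun u u' e ↦ ?_, fun H ↦ ?_⟩
  · refine hl.hom_ext (hQ.hom_ext fun d ↦ ?_) fun φ ↦ ?_
    · rw [Strict.assoc, Strict.assoc]
      exact Functor.congr_obj e d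
    · exact functor_map_heq e φ
  · obtain ⟨x, hx, -⟩ := hQ.one_dim H.obj
    obtain ⟨u, rfl, hu⟩ := hl.exists_lift x
      (fun φ ↦ eqToHom (hx _) ≫ H.map φ ≫ eqToHom (hx _).symm)
      (fun d ↦ by simp) (fun φ ψ ↦ by simp)
    exact ⟨u, Functor.hext (fun d ↦ (Strict.assoc _ _ _).symm.trans (hx d))
      (fun c d φ ↦ (hu φ).trans (eqToHom_conj_heq _ _ _))⟩

lemma HasFlexibleLimits.exists_power (h : HasFlexibleLimits K) (A : K) (S : SSet.{v}) :
    ∃ (P : K) (κ : S ⟶ sHom P A), IsPower κ := by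
  obtain ⟨P, F, hF⟩ := h.exists_powerFunctor (HoCat S) A
  obtain ⟨κ, hκ⟩ := (toHo_bijective S (P ⟶ A)).2 F
  refine ⟨P, κ, (isPower_iff κ).2 fun B ↦ ?_⟩
  convert hF B

/-- The functor `HoCat S ⥤ (P ⟶ A)` corresponding to a map `κ : S ⟶ sHom P A`. -/
abbrev actionFunctor {A P : K} {S : SSet.{v}} (κ : S ⟶ sHom P A) : HoCat S ⥤ (P ⟶ A) :=
  toHo (C := (P ⟶ A)) κ

/-- The functor between homotopy categories induced by a simplicial map. -/
abbrev hoMap {S T : SSet.{v}} (i : S ⟶ T) : HoCat S ⥤ HoCat T :=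
  SSet.Truncated.mapHomotopyCategory ((SSet.truncation 2).map i)

/-- The equation defining induced morphisms of powers, in terms of functors. -/
lemma IsPowerMap.comp_eq {A B P Q : K} {S T : SSet.{v}} {κ : T ⟶ sHom P A} {κ' : S ⟶ sHom Q B}
    {i : S ⟶ T} {p : A ⟶ B} {m : P ⟶ Q} (h : IsPowerMap κ κ' i p m) :
    actionFunctor κ' ⋙ precomp B m = hoMap i ⋙ actionFunctor κ ⋙ postcomp P p := by
  unfold IsPowerMap at h
  rw [eHomWhiskerLeft_eq, eHomWhiskerRight_eq] at h
  have := congrArg (toHo (C := (P ⟶ B))) h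
  refine Eq.trans (toHo_comp_nerveMap (C := (Q ⟶ B)) (D := (P ⟶ B)) κ'
    (precomp B m)).symm (this.trans ?_)
  exact (toHo_comp i _).trans
    (congrArg _ (toHo_comp_nerveMap (C := (P ⟶ A)) (D := (P ⟶ B)) κ (postcomp P p)))

end Power

/-! ### Leibniz powers -/

section Arrows

lemma arrow_mk_eq_of_heq {C : Type*} [Category* C] {a b a' b' : C} {f : a ⟶ b} {f' : a' ⟶ b'}
    (ha : a = a') (hb : b = b') (h : f ≍ f') : Arrow.mk f = Arrow.mk f' := by
  subst ha hb
  rw [eq_of_heq h]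

lemma arrow_mk_eqToHom_comp {C : Type*} [Category* C] {a b c : C} (h : a = b) (f : b ⟶ c) :
    Arrow.mk (eqToHom h ≫ f) = Arrow.mk f := by
  subst h
  simp

/-- A natural isomorphism out of a fixed functor is determined by its components, as arrows, and
then so is its codomain. -/
lemma arrow_mk_natIso_ext {C D : Type*} [Category* C] [Category* D] {G H H' : C ⥤ D} (a : G ≅ H)
    (a' : G ≅ H') (h : ∀ c, Arrow.mk (a.hom.app c) = Arrow.mk (a'.hom.app c)) :
    Arrow.mk a.hom = Arrow.mk a'.hom := by
  have hobj (c : C) : H.obj c = H'.obj c := congrArg (fun x : Arrow D ↦ x.right) (h c)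
  obtain ⟨b, hb⟩ : ∃ b : H ≅ H', b = a.symm ≪≫ a' := ⟨_, rfl⟩
  have hb' (c : C) : b.hom.app c = eqToHom (hobj c) := by
    have key {x y y' : D} (e : x ≅ y) (e' : x ≅ y') (hy : y = y')
        (he : Arrow.mk e.hom = Arrow.mk e'.hom) : e.inv ≫ e'.hom = eqToHom hy := by
      subst hy
      rw [← Arrow.mk_injective _ _ he]
      simp
    rw [hb]
    exact key (a.app c) (a'.app c) (hobj c) (h c)
  obtain rfl : H = H' := Functor.ext_of_iso b hobj hb'
  have : a.symm ≪≫ a' = Iso.refl H := by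
    rw [← hb]
    ext c
    simpa using hb' c
  have h' : a' = a := by
    rw [← Iso.self_symm_id_assoc a a', this, Iso.trans_refl]
  rw [h']

end Arrows

section PowerLifting

open Bicategory SimplicialCategory

variable {K : Type u} [Bicategory.{v, v} K] [Bicategory.Strict K]

lemma arrow_mk_whiskerRight_comp {A B C D : K} {f g : A ⟶ B} (η : f ⟶ g) (h : B ⟶ C) (k : C ⟶ D) :
    Arrow.mk (η ▷ h ▷ k) = Arrow.mk (η ▷ (h ≫ k)) :=
  arrow_mk_eq_of_heq (Strict.assoc _ _ _) (Strict.assoc _ _ _) (whiskerRight_comp_heq η h k).symm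

/-- Isomorphisms in the category of maps into a power can be lifted from families of isomorphisms:
a functor isomorphic to a given one is obtained by changing its values on objects. -/
lemma IsIsoFunctor.exists_iso {D : Type*} [Category* D] {A P X : K} {F : D ⥤ (P ⟶ A)}
    (hF : IsIsoFunctor (powerFunctor F X)) (c : X ⟶ P) (y : D → (X ⟶ A))
    (a : ∀ d, c ≫ F.obj d ≅ y d) :
    ∃ (c' : X ⟶ P) (β : c ≅ c'), ∀ d, Arrow.mk (β.hom ▷ F.obj d) = Arrow.mk (a d).hom := by
  obtain ⟨G, h₁, h₂⟩ := hF
  let H := (powerFunctor F X).obj c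
  let i : H ≅ H.copyObj y a := H.isoCopyObj y a
  have hc : G.obj H = c := Functor.congr_obj h₁ c
  let β := eqToIso hc.symm ≪≫ G.mapIso i
  refine ⟨_, β, fun d ↦ ?_⟩
  have h : Arrow.mk ((powerFunctor F X).map β.hom) = Arrow.mk i.hom := by
    have h₃ : Arrow.mk β.hom = Arrow.mk (G.map i.hom) := arrow_mk_eqToHom_comp hc.symm _
    refine (congrArg (powerFunctor F X).mapArrow.obj h₃).trans ?_
    exact congrArg (fun E : (D ⥤ (X ⟶ A)) ⥤ (D ⥤ (X ⟶ A)) ↦ Arrow.mk (E.map i.hom)) h₂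
  exact congrArg ((evaluation D (X ⟶ A)).obj d).mapArrow.obj h

/-- An isomorphism between 1-cells into a power is determined by its source and its components. -/
lemma IsIsoFunctor.arrow_mk_ext {D : Type*} [Category* D] {A P X : K} {F : D ⥤ (P ⟶ A)}
    (hF : IsIsoFunctor (powerFunctor F X)) {c w w' : X ⟶ P} (β : c ≅ w) (β' : c ≅ w')
    (h : ∀ d, Arrow.mk (β.hom ▷ F.obj d) = Arrow.mk (β'.hom ▷ F.obj d)) :
    Arrow.mk β.hom = Arrow.mk β'.hom := by
  obtain ⟨G, h₁, -⟩ := hF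
  have := arrow_mk_natIso_ext ((powerFunctor F X).mapIso β) ((powerFunctor F X).mapIso β') h
  have h₂ (γ : Arrow (X ⟶ P)) : G.mapArrow.obj ((powerFunctor F X).mapArrow.obj γ) = γ :=
    congrArg (fun E : (X ⟶ P) ⥤ (X ⟶ P) ↦ E.mapArrow.obj γ) h₁
  rw [← h₂ (Arrow.mk β.hom), ← h₂ (Arrow.mk β'.hom)]
  exact congrArg G.mapArrow.obj this

lemma IsPowerMap.obj_comp {A B P Q : K} {S T : SSet.{v}} {κ : T ⟶ sHom P A} {κ' : S ⟶ sHom Q B}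
    {i : S ⟶ T} {p : A ⟶ B} {m : P ⟶ Q} (h : IsPowerMap κ κ' i p m) (s : HoCat S) :
    m ≫ (actionFunctor κ').obj s = (actionFunctor κ).obj ((hoMap i).obj s) ≫ p :=
  Functor.congr_obj h.comp_eq s

lemma IsPowerMap.obj_comp_id {A B P Q : K} {S : SSet.{v}} {κ : S ⟶ sHom P A} {κ' : S ⟶ sHom Q B}
    {p : A ⟶ B} {m : P ⟶ Q} (h : IsPowerMap κ κ' (𝟙 S) p m) (s : HoCat S) :
    m ≫ (actionFunctor κ').obj s = (actionFunctor κ).obj s ≫ p := by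
  obtain ⟨s, rfl⟩ := SSet.Truncated.HomotopyCategory.mk_surjective s
  exact h.obj_comp _

lemma hoMap_obj_injective {S T : SSet.{v}} (i : S ⟶ T) [Mono i] :
    Function.Injective (hoMap i).obj := by
  intro x y h
  obtain ⟨x, rfl⟩ := SSet.Truncated.HomotopyCategory.mk_surjective x
  obtain ⟨y, rfl⟩ := SSet.Truncated.HomotopyCategory.mk_surjective y
  congr 1
  have h' := congrArg (fun z : HoCat T ↦ z.as.as) h
  exact (mono_iff_injective (i.app _)).1 inferInstance h'

/-- The power of a representable isofibration by a simplicial set. -/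
lemma repIsofib_powerMap {A B P Q : K} {S : SSet.{v}} {κ : S ⟶ sHom P A} {κ' : S ⟶ sHom Q B}
    (hκ : IsPower κ) (hκ' : IsPower κ') {p : A ⟶ B} {m : P ⟶ Q} (h : IsPowerMap κ κ' (𝟙 S) p m)
    (hp : repIsofib K p) : repIsofib K m := by
  change IsRepresentableIsofibration m
  rw [isRepresentableIsofibration_iff]
  intro X c d α
  have hp' := (isRepresentableIsofibration_iff p).1 hp X
  let F := actionFunctor κ
  let F' := actionFunctor κ'
  have e (s : HoCat S) : (c ≫ F.obj s) ≫ p = (c ≫ m) ≫ F'.obj s := by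
    rw [Strict.assoc, Strict.assoc, h.obj_comp_id]
  choose y a ha using fun s ↦ hp' (c ≫ F.obj s) (d ≫ F'.obj s)
    (eqToIso (e s) ≪≫ whiskerRightIso α (F'.obj s))
  obtain ⟨c', β, hβ⟩ := ((isPower_iff κ).1 hκ X).exists_iso c y a
  refine ⟨c', β, ((isPower_iff κ').1 hκ' X).arrow_mk_ext (whiskerRightIso β m) α fun s ↦ ?_⟩
  change Arrow.mk (β.hom ▷ m ▷ F'.obj s) = Arrow.mk (α.hom ▷ F'.obj s)
  rw [arrow_mk_whiskerRight_comp, h.obj_comp_id, ← arrow_mk_whiskerRight_comp]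
  refine (congrArg (postcomp X p).mapArrow.obj (hβ s)).trans ((ha s).trans ?_)
  exact arrow_mk_eqToHom_comp (e s) _

/-- Leibniz powers by monomorphisms: an isomorphism out of a composite `c ≫ l` amounts to
isomorphisms of functors on `S` and on `T`; the latter are lifted one object at a time, using the
former on the objects that come from `S`. -/
lemma repIsofib_of_isLeibnizPower {A B P L : K} {S T : SSet.{v}} {i : S ⟶ T} [Mono i] {p : A ⟶ B}
    {l : P ⟶ L} (hp : repIsofib K p) (hl : IsLeibnizPower i p l)
    (hpb : ∀ {A B D : K} (f : A ⟶ B) (g : D ⟶ B), repIsofib K f →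
      Enriched.HasConicalPullback SSet.{v} f g) : repIsofib K l := by
  obtain ⟨AS, BT, BS, κAT, κAS, κBT, κBS, pT, pS, Ai, Bi, fst, snd, ⟨hAT, hAS, hBT, hBS⟩, hpT, hpS,
    hAi, hBi, sq, rfl, rfl⟩ := hl
  have := hpb pS Bi (repIsofib_powerMap hAS hBS hpS hp)
  change IsRepresentableIsofibration l
  rw [isRepresentableIsofibration_iff]
  intro X c d α
  have hp' := (isRepresentableIsofibration_iff p).1 hp X
  let FAT := actionFunctor κAT
  let FAS := actionFunctor κAS
  let FBT := actionFunctor κBT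
  let J := hoMap i
  have eAi (s : HoCat S) : l ≫ fst ≫ FAS.obj s = FAT.obj (J.obj s) := by
    rw [← Strict.assoc, hAi.obj_comp, Strict.comp_id]
  have epT (t : HoCat T) : l ≫ snd ≫ FBT.obj t = FAT.obj t ≫ p := by
    rw [← Strict.assoc, hpT.obj_comp_id]
  have eL (s : HoCat S) : (fst ≫ FAS.obj s) ≫ p = snd ≫ FBT.obj (J.obj s) := by
    have := hBi.obj_comp s
    rw [Strict.comp_id] at this
    rw [← this, Strict.assoc, ← hpS.obj_comp_id, ← Strict.assoc, ← Strict.assoc]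
    exact congrArg (· ≫ _) sq.w
  -- The given components, at the objects coming from `S`.
  have eb (s : HoCat S) : c ≫ FAT.obj (J.obj s) = (c ≫ l) ≫ fst ≫ FAS.obj s := by
    rw [← eAi, ← Strict.assoc]
  let b (s : HoCat S) : c ≫ FAT.obj (J.obj s) ≅ d ≫ fst ≫ FAS.obj s := eqToIso (eb s) ≪≫
    whiskerRightIso α (fst ≫ FAS.obj s)
  have hb (s : HoCat S) : Arrow.mk (b s).hom = Arrow.mk (α.hom ▷ (fst ≫ FAS.obj s)) :=
    arrow_mk_eqToHom_comp (eb s) _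
  -- The given components in `B`.
  have ea (t : HoCat T) : (c ≫ FAT.obj t) ≫ p = (c ≫ l) ≫ snd ≫ FBT.obj t := by
    rw [Strict.assoc, ← epT, ← Strict.assoc]
  let a (t : HoCat T) := eqToIso (ea t) ≪≫ whiskerRightIso α (snd ≫ FBT.obj t)
  have ha (t : HoCat T) : Arrow.mk (a t).hom = Arrow.mk (α.hom ▷ (snd ≫ FBT.obj t)) :=
    arrow_mk_eqToHom_comp (ea t) _
  have key (t : HoCat T) : ∃ (y : X ⟶ A) (e : c ≫ FAT.obj t ≅ y),
      (∀ s, J.obj s = t → Arrow.mk e.hom = Arrow.mk (b s).hom) ∧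
        Arrow.mk (e.hom ▷ p) = Arrow.mk (a t).hom := by
    by_cases ht : ∃ s, J.obj s = t
    · obtain ⟨s, rfl⟩ := ht
      refine ⟨_, b s, fun s' hs ↦ by rw [hoMap_obj_injective i hs], ?_⟩
      refine (congrArg (postcomp X p).mapArrow.obj (hb s)).trans (Eq.trans ?_ (ha _).symm)
      exact (arrow_mk_whiskerRight_comp _ _ _).trans (by rw [eL])
    · obtain ⟨y, e, he⟩ := hp' (c ≫ FAT.obj t) (d ≫ snd ≫ FBT.obj t) (a t)
      exact ⟨y, e, fun s hs ↦ (ht ⟨s, hs⟩).elim, he⟩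
  choose y e he he' using key
  obtain ⟨c', β, hβ⟩ := ((isPower_iff κAT).1 hAT X).exists_iso c y e
  refine ⟨c', β, ?_⟩
  have hfst : Arrow.mk (β.hom ▷ l ▷ fst) = Arrow.mk (α.hom ▷ fst) := by
    refine ((isPower_iff κAS).1 hAS X).arrow_mk_ext
      (whiskerRightIso (whiskerRightIso β l) fst) (whiskerRightIso α fst) fun s ↦ ?_
    change Arrow.mk (β.hom ▷ l ▷ fst ▷ FAS.obj s) = Arrow.mk (α.hom ▷ fst ▷ FAS.obj s)
    rw [arrow_mk_whiskerRight_comp, arrow_mk_whiskerRight_comp, arrow_mk_whiskerRight_comp, eAi]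
    exact (hβ _).trans ((he _ s rfl).trans (hb s))
  have hsnd : Arrow.mk (β.hom ▷ l ▷ snd) = Arrow.mk (α.hom ▷ snd) := by
    refine ((isPower_iff κBT).1 hBT X).arrow_mk_ext
      (whiskerRightIso (whiskerRightIso β l) snd) (whiskerRightIso α snd) fun t ↦ ?_
    change Arrow.mk (β.hom ▷ l ▷ snd ▷ FBT.obj t) = Arrow.mk (α.hom ▷ snd ▷ FBT.obj t)
    rw [arrow_mk_whiskerRight_comp, arrow_mk_whiskerRight_comp, arrow_mk_whiskerRight_comp, epT,
      ← arrow_mk_whiskerRight_comp]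
    exact (congrArg (postcomp X p).mapArrow.obj (hβ t)).trans ((he' t).trans (ha t))
  refine arrow_ext_of_isLimit sq.isLimit fun j ↦ ?_
  obtain _ | _ | _ := j
  · change Arrow.mk (β.hom ▷ l ▷ (fst ≫ pS)) = Arrow.mk (α.hom ▷ (fst ≫ pS))
    rw [← arrow_mk_whiskerRight_comp, ← arrow_mk_whiskerRight_comp]
    exact congrArg (postcomp X pS).mapArrow.obj hfst
  · exact hfst
  · exact hsnd

end PowerLifting

/-! ### The representable isofibrations form a 2-cosmos structure -/

section Existence

open Bicategory SimplicialCategory Limits Opposite Enriched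

variable {K : Type u} [Bicategory.{v, v} K] [Bicategory.Strict K]

/-- There is only one 2-cell between maps into a terminal object, since it is terminal in the
enriched sense. -/
lemma repIsofib_of_isTerminal [HasConicalProducts.{v} SSet.{v} K] {A T : K} (f : A ⟶ T)
    (hT : IsTerminal T) : repIsofib K f := by
  change IsRepresentableIsofibration f
  rw [isRepresentableIsofibration_iff]
  intro X c d α
  let F : PEmpty.{v + 1} → K := PEmpty.elim
  have hc : IsLimit (Fan.mk T (fun j ↦ j.elim) : Fan F) :=
    Fan.IsLimit.mk _ (fun s ↦ hT.from _) (fun s j ↦ j.elim) (fun s m _ ↦ hT.hom_ext _ _)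
  exact ⟨c, Iso.refl c, arrow_ext_of_isLimit hc fun ⟨j⟩ ↦ j.elim⟩

/-- Existence: the representable isofibrations form a Cauchy-complete 2-cosmos structure. -/
theorem isCauchyCompleteTwoCosmos_repIsofib (hflex : HasFlexibleLimits K)
    (hnormal : ∀ {A B : K} (f : A ⟶ B), IsRepresentableIsofibration f → IsNormalIsofibration f) :
    IsCauchyCompleteTwoCosmos K (repIsofib K) := by
  have hprod : HasConicalProducts.{v} SSet.{v} K := hflex.hasConicalProducts
  have hpb {A B D : K} (f : A ⟶ B) (g : D ⟶ B) (hf : repIsofib K f) :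
      HasConicalPullback SSet.{v} f g := hflex.hasConicalPullback (hnormal f hf) g
  have htower (F : ℕᵒᵖ ⥤ K) (hF : IsTowerOf (repIsofib K) F) : HasConicalLimit SSet.{v} F :=
    hflex.hasConicalLimit_tower F fun n ↦ hnormal _ (hF n)
  refine ⟨?_, hflex.idempotents, inferInstance⟩
  exact
    { comp := inferInstance
      iso := fun f _ ↦ repIsofib_of_isIso f
      quasicategory := fun A B ↦ (inferInstance : SSet.Quasicategory (nerve (A ⟶ B)))
      hom_isofibration := fun A _ _ p hp ↦ (isQCatIsofibration_eHomWhiskerLeft_iff A p).2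
        ((isRepresentableIsofibration_iff p).1 hp A)
      hasProducts := hprod
      hasPowers := hflex.exists_power
      hasPullbacks := hpb
      hasTowerLimits := htower
      pullback := ⟨fun {_ _ _ _ f g _ _} sq hp ↦ by
        have := hpb g f hp
        exact @repIsofib_of_isPullback K _ _ _ _ _ _ _ _ _ _ sq this hp⟩
      product := fun J ↦ repIsofib_isStableUnderProducts J
      towerLimit := fun F hF c ⟨hc⟩ ↦ by
        have := htower F hF
        exact repIsofib_tower_π_zero F hF hc
      leibniz := fun i _ _ p _ hp _ _ l hl ↦ repIsofib_of_isLeibnizPower hp hl hpb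
      terminal := fun f ⟨hT⟩ ↦ repIsofib_of_isTerminal f hT }

end Existence

/-! ### Powers by nerves -/

section NervePowers

open Bicategory SimplicialCategory

variable {K : Type u} [Bicategory.{v, v} K] [Bicategory.Strict K]

lemma isIsoFunctor_toHo_id (D : Type v) [SmallCategory D] :
    IsIsoFunctor (toHo.{v} (𝟙 (nerve.{v, v} D))) := by
  obtain ⟨G, hG⟩ := (toHo_id_bijective D (HoCat (nerve.{v, v} D))).2 (𝟭 _)
  refine ⟨G, hG, (toHo_id_bijective D D).1 ?_⟩
  exact congrArg (fun H : HoCat (nerve.{v, v} D) ⥤ HoCat (nerve.{v, v} D) ↦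
    H ⋙ toHo.{v} (𝟙 (nerve.{v, v} D))) hG

lemma IsIsoFunctor.comp {C D E : Type*} [Category* C] [Category* D] [Category* E] {F : C ⥤ D}
    {G : D ⥤ E} (hF : IsIsoFunctor F) (hG : IsIsoFunctor G) : IsIsoFunctor (F ⋙ G) := by
  obtain ⟨F', h₁, h₂⟩ := hF
  obtain ⟨G', h₃, h₄⟩ := hG
  refine ⟨G' ⋙ F', ?_, ?_⟩
  · change F ⋙ (G ⋙ G') ⋙ F' = _
    rw [h₃]
    exact h₁
  · change G' ⋙ (F' ⋙ F) ⋙ G = _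
    rw [h₂]
    exact h₄

lemma IsIsoFunctor.whiskeringLeft {C D : Type*} [Category* C] [Category* D] {F : C ⥤ D}
    (hF : IsIsoFunctor F) (E : Type*) [Category* E] :
    IsIsoFunctor ((Functor.whiskeringLeft C D E).obj F) := by
  obtain ⟨F', h₁, h₂⟩ := hF
  refine ⟨(Functor.whiskeringLeft D C E).obj F', ?_, ?_⟩
  · change (Functor.whiskeringLeft D D E).obj (F' ⋙ F) = _
    rw [h₂]
    rfl
  · change (Functor.whiskeringLeft C C E).obj (F ⋙ F') = _
    rw [h₁]
    rfl

/-- A 2-categorical power by a small category is a simplicial power by its nerve. -/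
lemma isPower_nerveMap {D : Type v} [SmallCategory D] {A P : K} (F : D ⥤ (P ⟶ A))
    (hF : ∀ X : K, IsIsoFunctor (powerFunctor F X)) :
    IsPower (show nerve.{v, v} D ⟶ sHom P A from nerveMap.{v, v} F) := by
  refine (isPower_iff _).2 fun X ↦ ?_
  have h := (hF X).comp ((isIsoFunctor_toHo_id D).whiskeringLeft (X ⟶ A))
  convert h using 1
  have : toHo.{v} (C := (P ⟶ A)) (nerveMap.{v, v} F : nerve.{v, v} D ⟶ nerve.{v, v} (P ⟶ A)) =
      toHo.{v} (𝟙 (nerve.{v, v} D)) ⋙ F := by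
    rw [← toHo_comp_nerveMap, Category.id_comp]
  change powerFunctor (toHo.{v} (C := (P ⟶ A))
    (nerveMap.{v, v} F : nerve.{v, v} D ⟶ nerve.{v, v} (P ⟶ A))) X = _
  rw [this]
  rfl

lemma isPowerMap_nerveMap {D E : Type v} [SmallCategory D] [SmallCategory E] {A B P Q : K}
    {F : D ⥤ (P ⟶ A)} {F' : E ⥤ (Q ⟶ B)} {J : E ⥤ D} {p : A ⟶ B} {m : P ⟶ Q}
    (h : F' ⋙ precomp B m = J ⋙ F ⋙ postcomp P p) :
    IsPowerMap (show nerve.{v, v} D ⟶ sHom P A from nerveMap.{v, v} F)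
      (show nerve.{v, v} E ⟶ sHom Q B from nerveMap.{v, v} F') (nerveMap.{v, v} J) p m := by
  unfold IsPowerMap
  rw [eHomWhiskerLeft_eq, eHomWhiskerRight_eq]
  exact congrArg (fun G : E ⥤ (P ⟶ B) ↦
    (nerveMap.{v, v} G : nerve.{v, v} E ⟶ nerve.{v, v} (P ⟶ B))) h

lemma mono_nerveMap_of_isDiscrete {D E : Type v} [SmallCategory D] [SmallCategory E]
    [IsDiscrete E] (J : E ⥤ D) (hJ : Function.Injective J.obj) :
    Mono (nerveMap.{v, v} J : nerve.{v, v} E ⟶ nerve.{v, v} D) := by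
  have (n : SimplexCategoryᵒᵖ) :
      Mono ((nerveMap.{v, v} J : nerve.{v, v} E ⟶ nerve.{v, v} D).app n) := by
    rw [mono_iff_injective]
    intro x y h
    change ComposableArrows E _ at x y
    refine CategoryTheory.Functor.ext (fun i ↦ hJ (Functor.congr_obj (h : x ⋙ J = y ⋙ J) i))
      fun i j f ↦ Subsingleton.elim _ _
  exact NatTrans.mono_of_mono_app _

/-- `T` is terminal in the 2-categorical sense. -/
structure IsTwoTerminal (T : K) : Prop where
  exists_hom : ∀ X : K, Nonempty (X ⟶ T)
  hom_ext : ∀ {X : K} (a b : X ⟶ T), a = b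
  cell_ext : ∀ {X : K} {a b : X ⟶ T} (γ γ' : a ⟶ b), γ = γ'

lemma HasFlexibleLimits.exists_twoTerminal (h : HasFlexibleLimits K) :
    ∃ T : K, IsTwoTerminal T := by
  obtain ⟨T, π, hT⟩ := h.products (PEmpty.elim : PEmpty.{v + 1} → K)
  exact ⟨T, fun X ↦ ⟨(hT.one_dim (X := X) (fun j ↦ j.elim)).choose⟩,
    fun a b ↦ hT.hom_ext (fun j ↦ j.elim), fun γ γ' ↦ hT.cell_ext (fun j ↦ j.elim)⟩

namespace IsTwoTerminal

variable {T : K}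

lemma functor_ext (hT : IsTwoTerminal T) {D : Type*} [Category* D] {X : K}
    (G G' : D ⥤ (X ⟶ T)) : G = G' :=
  CategoryTheory.Functor.ext (fun _ ↦ hT.hom_ext _ _) (fun _ _ _ ↦ hT.cell_ext _ _)

/-- A terminal object is its own power by any category, in a unique way. -/
lemma isIsoFunctor_powerFunctor (hT : IsTwoTerminal T) {D : Type*} [Category* D]
    (F : D ⥤ (T ⟶ T)) (X : K) : IsIsoFunctor (powerFunctor F X) := by
  obtain ⟨t⟩ := hT.exists_hom X
  refine ⟨(Functor.const _).obj t, hT.functor_ext _ _, ?_⟩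
  refine CategoryTheory.Functor.ext (fun _ ↦ hT.functor_ext _ _) fun _ _ _ ↦ ?_
  ext
  exact hT.cell_ext _ _

end IsTwoTerminal

end NervePowers

/-! ### Uniqueness of the class of isofibrations -/

section Uniqueness

open Bicategory SimplicialCategory Limits

variable {K : Type u} [Bicategory.{v, v} K] [Bicategory.Strict K]

/-- The inclusion of the two objects into the free-living isomorphism. -/
def endpoints : Discrete (ULift.{v} Bool) ⥤ ULiftHom.{v} WalkingIso.{v} :=
  Discrete.functor fun b ↦ ULiftHom.objUp (if b.down then .one else .zero)

lemma endpoints_obj_injective : Function.Injective endpoints.{v}.obj := by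
  rintro ⟨⟨_ | _⟩⟩ ⟨⟨_ | _⟩⟩ h
  · rfl
  · cases h
  · cases h
  · rfl

lemma discrete_functor_ext {D : Type*} [Category* D] {J : Type*} {G G' : Discrete J ⥤ D}
    (h : ∀ j, G.obj ⟨j⟩ = G'.obj ⟨j⟩) : G = G' :=
  CategoryTheory.Functor.ext (fun ⟨j⟩ ↦ h j) (by
    rintro ⟨i⟩ ⟨j⟩ f
    obtain rfl : i = j := Discrete.eq_of_hom f
    obtain rfl : f = 𝟙 _ := Subsingleton.elim _ _
    simp)

/-- The object `E` of triples `(a, b, f a ≅ b)`, its projections `k` and `h` to `A` and `B`, the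
universal isomorphism `φ`, and the section `s` given by `a ↦ (a, f a, 𝟙)`. It is constructed so
that `h` is an isofibration in any given 2-cosmos structure: the restriction of isomorphisms
in `B` to pairs of objects of `B` is a Leibniz power of `B ⟶ 1`, hence an isofibration; `E ⟶ A × B`
is a pullback of it, and `A × B ⟶ B` is a pullback of `A ⟶ 1`. -/
lemma IsInfinityCosmos.exists_isoComma {W : MorphismProperty K} (hW : IsInfinityCosmos K W)
    (hflex : HasFlexibleLimits K) {A B : K} (f : A ⟶ B) :
    ∃ (E : K) (k : E ⟶ A) (h : E ⟶ B) (φ : k ≫ f ≅ h) (s : A ⟶ E), W h ∧ s ≫ k = 𝟙 A ∧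
      s ≫ h = f ∧ s ◁ φ.hom ≍ 𝟙 f := by
  have := hW.comp
  have := hW.pullback
  obtain ⟨T, hT⟩ := hflex.exists_twoTerminal
  have hT' : Nonempty (IsTerminal T) :=
    ⟨IsTerminal.ofUniqueHom (fun X ↦ (hT.exists_hom X).some) (fun _ _ ↦ hT.hom_ext _ _)⟩
  obtain ⟨a⟩ := hT.exists_hom A
  obtain ⟨b⟩ := hT.exists_hom B
  have hb : W b := hW.terminal b hT'
  have ha : W a := hW.terminal a hT'
  -- The projection of the product `Q = A × B` to `B` is a pullback of `a`.
  have := hW.hasPullbacks a b ha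
  let Q := Limits.pullback a b
  let p₁ : Q ⟶ A := Limits.pullback.fst a b
  let p₂ : Q ⟶ B := Limits.pullback.snd a b
  have hp₂ : W p₂ := W.of_isPullback (IsPullback.of_hasPullback a b) ha
  -- The powers of `B` by two points and by the free-living isomorphism.
  let D := ULiftHom.{v} WalkingIso.{v}
  let i : (ULiftHom.objUp .zero : D) ≅ ULiftHom.objUp .one := ULiftHom.up.mapIso WalkingIso.iso
  obtain ⟨BT, FT, hFT⟩ := hflex.exists_powerFunctor D B
  obtain ⟨BS, FS, hFS⟩ := hflex.exists_powerFunctor (Discrete (ULift.{v} Bool)) B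
  have hsurj {X : K} (G : Discrete (ULift.{v} Bool) ⥤ (X ⟶ B)) :
      ∃ u : X ⟶ BS, (powerFunctor FS X).obj u = G := by
    obtain ⟨H, -, hH⟩ := hFS X
    exact ⟨H.obj G, Functor.congr_obj hH G⟩
  have hinj {X : K} {u w : X ⟶ BS} (h : ∀ b, u ≫ FS.obj b = w ≫ FS.obj b) : u = w := by
    obtain ⟨H, hH, -⟩ := hFS X
    have h' : (powerFunctor FS X).obj u = (powerFunctor FS X).obj w :=
      discrete_functor_ext fun b ↦ h ⟨b⟩
    exact (Functor.congr_obj hH u).symm.trans ((congrArg H.obj h').trans (Functor.congr_obj hH w))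
  obtain ⟨r, hr⟩ := hsurj (endpoints ⋙ FT)
  have hr' (b) : r ≫ FS.obj b = FT.obj (endpoints.obj b) := Functor.congr_obj hr b
  have hWr : W r := by
    obtain ⟨bS⟩ := hT.exists_hom BS
    obtain ⟨bT⟩ := hT.exists_hom BT
    have := mono_nerveMap_of_isDiscrete endpoints.{v} endpoints_obj_injective
    -- The powers of `T` are `T` itself, so that the pullback in the Leibniz power is `BS`.
    refine hW.leibniz (nerveMap.{v, v} endpoints.{v}) b this hb r
      ⟨BS, T, T, nerveMap.{v, v} FT, nerveMap.{v, v} FS,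
        nerveMap.{v, v} ((Functor.const D).obj (𝟙 T)),
        nerveMap.{v, v} ((Functor.const _).obj (𝟙 T)),
        bT, bS, r, 𝟙 T, 𝟙 BS, bS,
        ⟨isPower_nerveMap FT hFT, isPower_nerveMap FS hFS,
          isPower_nerveMap _ (hT.isIsoFunctor_powerFunctor _),
          isPower_nerveMap _ (hT.isIsoFunctor_powerFunctor _)⟩,
        isPowerMap_nerveMap (J := 𝟭 _) (hT.functor_ext _ _),
        isPowerMap_nerveMap (J := 𝟭 _) (hT.functor_ext _ _),
        isPowerMap_nerveMap ?_, isPowerMap_nerveMap (hT.functor_ext _ _),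
        IsPullback.of_horiz_isIso ⟨hT.hom_ext _ _⟩, Category.comp_id _, hT.hom_ext _ _⟩
    refine discrete_functor_ext fun b ↦ (hr' _).trans (Category.comp_id _).symm
  -- `E` is the pullback of `r` along the map classifying the pair `p₁ ≫ f, p₂`.
  obtain ⟨c, hc⟩ := hsurj (Discrete.functor fun b ↦ if b.down then p₂ else p₁ ≫ f)
  have hc₀ : c ≫ FS.obj ⟨⟨false⟩⟩ = p₁ ≫ f := Functor.congr_obj hc ⟨⟨false⟩⟩
  have hc₁ : c ≫ FS.obj ⟨⟨true⟩⟩ = p₂ := Functor.congr_obj hc ⟨⟨true⟩⟩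
  have := hW.hasPullbacks r c hWr
  let q₁ := Limits.pullback.fst r c
  let q₂ := Limits.pullback.snd r c
  have hq : q₁ ≫ r = q₂ ≫ c := Limits.pullback.condition
  have hq₂ : W q₂ := W.of_isPullback (IsPullback.of_hasPullback r c) hWr
  have e₀ : (q₂ ≫ p₁) ≫ f = q₁ ≫ FT.obj (ULiftHom.objUp .zero) := by
    rw [Category.assoc, ← hc₀, ← Category.assoc, ← hq, Category.assoc, hr']
    rfl
  have e₁ : q₁ ≫ FT.obj (ULiftHom.objUp .one) = q₂ ≫ p₂ := by
    rw [← hc₁, ← Category.assoc, ← hq, Category.assoc, hr']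
    rfl
  -- The section is induced by the constant functor at `f`, an identity isomorphism.
  obtain ⟨w, hw⟩ : ∃ w : A ⟶ BT, (powerFunctor FT A).obj w = (Functor.const D).obj f := by
    obtain ⟨H, -, hH⟩ := hFT A
    exact ⟨H.obj _, Functor.congr_obj hH _⟩
  have hw' (d : D) : w ≫ FT.obj d = f := Functor.congr_obj hw d
  let s₂ : A ⟶ Q := Limits.pullback.lift (𝟙 A) f (hT.hom_ext _ _)
  have hs₁ : s₂ ≫ p₁ = 𝟙 A := Limits.pullback.lift_fst _ _ _
  have hs₂ : s₂ ≫ p₂ = f := Limits.pullback.lift_snd _ _ _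
  have hs : w ≫ r = s₂ ≫ c := by
    refine hinj fun b ↦ ?_
    rw [Category.assoc, hr', hw', Category.assoc]
    obtain ⟨⟨_ | _⟩⟩ := b
    · rw [hc₀, ← Category.assoc, hs₁, Category.id_comp]
    · rw [hc₁, hs₂]
  let s := Limits.pullback.lift w s₂ hs
  have hsq₁ : s ≫ q₁ = w := Limits.pullback.lift_fst _ _ _
  have hsq₂ : s ≫ q₂ = s₂ := Limits.pullback.lift_snd _ _ _
  refine ⟨Limits.pullback r c, q₂ ≫ p₁, q₂ ≫ p₂,
    eqToIso e₀ ≪≫ whiskerLeftIso q₁ (FT.mapIso i) ≪≫ eqToIso e₁, s, W.comp_mem _ _ hq₂ hp₂,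
    by rw [← Category.assoc, hsq₂, hs₁], by rw [← Category.assoc, hsq₂, hs₂], ?_⟩
  refine (whiskerLeft_heq e₀ e₁.symm (eqToHom_conj_heq _ e₀ e₁) s).trans ?_
  refine (comp_whiskerLeft_heq _ _ _).symm.trans ((whiskerLeft_congr_heq hsq₁ _).trans ?_)
  exact functor_map_heq hw i.hom

/-- A normal isofibration is a retract of the projection `E ⟶ B` from the object `E` of isomorphisms
`f a ≅ b`: the cleavage sends such an isomorphism to an object of `A` over `b`, and by normality
the identity of `f a` to `a`. -/
lemma IsInfinityCosmos.of_isNormalIsofibration {W : MorphismProperty K}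
    (hW : IsInfinityCosmos K W) (hret : W.IsStableUnderRetracts) (hflex : HasFlexibleLimits K)
    {A B : K} {f : A ⟶ B} (hf : IsNormalIsofibration f) : W f := by
  obtain ⟨E, k, h, φ, s, hh, hsk, hsh, hs⟩ := hW.exists_isoComma hflex f
  obtain ⟨-, c, hc⟩ := hf
  let ρ := c.lift k h φ
  have hsρ : s ≫ ρ.obj = 𝟙 A := by
    refine (hc.restrict_lift_eq s φ ?_ ?_).1.trans hsk
    · rw [hsk, Strict.id_comp, hsh]
    · exact hs.trans (id_heq_id hsh.symm)
  refine MorphismProperty.of_retract (f := f) (g := h)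
    { i := Arrow.homMk s (𝟙 B) (by simpa using! hsh)
      r := Arrow.homMk ρ.obj (𝟙 B) (by simpa using! ρ.obj_comp)
      retract := by
        ext
        · exact hsρ
        · exact Category.comp_id _ } hh

/-- In any Cauchy-complete 2-cosmos structure, the isofibrations are the representable
isofibrations. -/
lemma IsCauchyCompleteTwoCosmos.eq_repIsofib {W : MorphismProperty K}
    (hW : IsCauchyCompleteTwoCosmos K W) (hflex : HasFlexibleLimits K)
    (hnormal : ∀ {A B : K} (f : A ⟶ B), IsRepresentableIsofibration f → IsNormalIsofibration f) :
    W = repIsofib K := by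
  ext A B f
  constructor
  · intro hf
    change IsRepresentableIsofibration f
    rw [isRepresentableIsofibration_iff]
    exact fun X ↦ (isQCatIsofibration_eHomWhiskerLeft_iff X f).1
      (hW.cosmos.hom_isofibration X f hf)
  · exact fun hf ↦ hW.cosmos.of_isNormalIsofibration hW.retracts hflex (hnormal f hf)

end Uniqueness

end TwoCosmos

theorem corollary4p5 {K : Type u} [Bicategory.{v, v} K] [Bicategory.Strict K]
    (hflex : TwoCosmos.HasFlexibleLimits K)
    (hnormal : ∀ {A B : K} (f : A ⟶ B),
      TwoCosmos.IsRepresentableIsofibration f → TwoCosmos.IsNormalIsofibration f) :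
    ∃! W : MorphismProperty K, TwoCosmos.IsCauchyCompleteTwoCosmos K W :=
  ⟨TwoCosmos.repIsofib K, TwoCosmos.isCauchyCompleteTwoCosmos_repIsofib hflex hnormal,
    fun _ hW ↦ hW.eq_repIsofib hflex hnormal⟩
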